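/- Let $\Bbbk$ be an algebraically closed field of characteristic zero and let $A$ be an affine Poisson $\Bbbk$-algebra, that is, a finitely generated commutative $\Bbbk$-algebra with a $\Bbbk$-bilinear Lie bracket $\{-,-\}$ on $A$ such that $\{ab,c\}=a\{b,c\}+\{a,c\}b$ for all $a,b,c\in A$. Let $\mathcal{U}(A)$ be its Poisson enveloping algebra: the associative unital $\Bbbk$-algebra generated by two copies $m_A=\{m_a : a\in A\}$ and $h_A=\{h_a : a\in A\}$ of the vector space $A$ (so that $a\mapsto m_a$ and $a\mapsto h_a$ are $\Bbbk$-linear), subject to the relations, for all $x,y\in A$, $$m_{xy}=m_xm_y,\quad h_{\{x,y\}}=h_xh_y-h_yh_x,\quad h_{xy}=m_yh_x+m_xh_y,\quad m_{\{x,y\}}=h_xm_y-m_yh_x,\quad m_1=1.$$ If $A$ is a regular ring (all its localizations at prime ideals are regular local rings) of global dimension $t\in\mathbb{N}$, then $$\mathrm{GKdim}(\mathcal{U}(A))=2t,$$ where $\mathrm{GKdim}(R)=\sup_V\limsup_{n\to\infty}\log_n\dim_{\Bbbk}(\Bbbk+V+\cdots+V^n)$, the supremum being taken over all finite-dimensional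 subspaces $V$ of $R$. -/

import Mathlib

universe u v

/-- A Poisson algebra structure on a commutative `k`-algebra `A`: a `k`-bilinear Lie bracket
satisfying the Leibniz rule. -/
class PoissonAlgebra (k : Type u) (A : Type v) [CommRing k] [CommRing A] [Algebra k A] where
  /-- The Poisson bracket, as a `k`-bilinear map. -/
  bracket : A →ₗ[k] A →ₗ[k] A
  bracket_self (a : A) : bracket a a = 0
  jacobi (a b c : A) :
    bracket a (bracket b c) + bracket b (bracket c a) + bracket c (bracket a b) = 0
  leibniz (a b c : A) : bracket (a * b) c = a * bracket b c + bracket a c * b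

namespace PoissonAlgebra

section Envelope

variable (k : Type u) (A : Type v) [CommRing k] [CommRing A] [Algebra k A]

/-- The free generator `m_a`. The vector space `A × A` is the direct sum of the two copies `m_A`
and `h_A` of `A`, and its tensor algebra is the free associative algebra on these spaces. -/
def freeM (a : A) : TensorAlgebra k (A × A) := TensorAlgebra.ι k (a, 0)

/-- The free generator `h_a`. -/
def freeH (a : A) : TensorAlgebra k (A × A) := TensorAlgebra.ι k (0, a)

variable [PoissonAlgebra k A]

/-- The defining relations of the Poisson enveloping algebra. -/
inductive EnvelopingRel : TensorAlgebra k (A × A) → TensorAlgebra k (A × A) → Prop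
  | m_mul (x y : A) : EnvelopingRel (freeM k A (x * y)) (freeM k A x * freeM k A y)
  | h_bracket (x y : A) : EnvelopingRel (freeH k A (bracket (k := k) x y))
      (freeH k A x * freeH k A y - freeH k A y * freeH k A x)
  | h_mul (x y : A) : EnvelopingRel (freeH k A (x * y))
      (freeM k A y * freeH k A x + freeM k A x * freeH k A y)
  | m_bracket (x y : A) : EnvelopingRel (freeM k A (bracket (k := k) x y))
      (freeH k A x * freeM k A y - freeM k A y * freeH k A x)
  | m_one : EnvelopingRel (freeM k A 1) 1

/-- The universal (Poisson) enveloping algebra `U(A)`: the associative unital `k`-algebra generated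
by the spaces `m_A` and `h_A` subject to the relations above. -/
def Enveloping : Type (max u v) := RingQuot (EnvelopingRel k A)

noncomputable instance : Ring (Enveloping k A) := inferInstanceAs (Ring (RingQuot _))

noncomputable instance : Algebra k (Enveloping k A) := inferInstanceAs (Algebra k (RingQuot _))

end Envelope

end PoissonAlgebra

/-- The Gelfand-Kirillov dimension of a `k`-algebra `R`: the supremum, over all finite-dimensional
subspaces `V` of `R`, of `limsup_n log_n dim_k (k + V + V² + ⋯ + Vⁿ)`. -/
noncomputable def gelfandKirillovDim (k : Type u) (R : Type v) [Field k] [Ring R] [Algebra k R] :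
    EReal :=
  ⨆ (V : Submodule k R) (_ : FiniteDimensional k V),
    Filter.limsup (fun n : ℕ =>
      ((Real.logb n (Module.finrank k ↥(⨆ i ∈ Finset.range (n + 1), V ^ i)) : ℝ) : EReal))
      Filter.atTop

/-- The global dimension of a commutative ring `R`: the supremum of the projective dimensions of all
`R`-modules. (It is `⊥` exactly for the zero ring.) -/
noncomputable def globalDim (R : Type v) [CommRing R] : WithBot ℕ∞ :=
  ⨆ M : ModuleCat.{v} R, CategoryTheory.projectiveDimension M

/-!
The theorem is the equality of two bounds for the growth of `U(A)`, where `d` is the Krull dimension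
of `A`.

*Dimension.* For a regular ring the global dimension is the Krull dimension
(`globalDim_eq_ringKrullDim`): over a regular local ring, induction on the dimension, cutting by one
parameter at a time, bounds the projective dimensions of finite modules, and the quotient by a
regular sequence of maximal length attains the bound. Hence `t = d`.

*Lower bound.* By Noether normalization `A` is finite over a polynomial ring in `y 1, …, y d`. Over
the field of fractions `K` of a component of `A` on which the `y i` stay algebraically independent,
the `d y i` form a basis of the Kähler differentials, because `K` is formally étale over the
polynomial ring in characteristic zero (`PoissonAlgebra.exists_coordinates`). The Poisson bracket
makes these differentials a Lie–Rinehart algebra, and a Poincaré–Birkhoff–Witt argument for its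
basis (`LieRinehartFrame.act_comm`) yields a representation of `U(A)` on polynomials over `K` in `d`
variables, in which the ordered monomials in the `h_{y i}` send `1` to the corresponding monomials.
So the products of monomials in the `m_{y i}` and ordered monomials in the `h_{y i}` are linearly
independent (`PoissonAlgebra.Coordinates.linearIndependent_enveloping`), which gives growth of
degree at least `2 * d`.

*Upper bound.* The differentials of `A` are locally generated by `d` exact ones: by regularity each
maximal ideal is locally generated by `d` elements, and Nakayama's lemma applies
(`exists_smul_D_mem_span`). As `a ↦ h_a` is a derivation, for a suitable `f` every `m_f * h_a` is a
combination of `d` elements `h_{y i}`. Commuting the `h_{y i}` into order costs powers of `f` only,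
one for each factor, and raises the degree of the coefficients in a bounded way
(`PoissonAlgebra.IsAdapted.h_mul_hProd_sub_mem`). Hence `f ^ (2 * n)` sends the `n`-th power of a
generating space into a space of ordered monomials of degree at most `2 * n` with coefficients in a
power of a finite-dimensional subspace of `A`; its dimension is `O(n ^ d)` for the monomials times
`O(n ^ d)` for the coefficients. Finitely many such `f` generate the unit ideal, so their powers
detect every element of `U(A)` (`PoissonAlgebra.gelfandKirillovDim_enveloping_le`).
-/

/-! ### Global dimension of regular rings -/

section RegularLocal

open IsLocalRing RingTheory.Sequence

/-- A regular local ring of dimension zero is a field. -/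
lemma IsRegularLocalRing.isField_of_ringKrullDim_eq_zero {R : Type*} [CommRing R]
    [IsRegularLocalRing R] (h : ringKrullDim R = 0) : IsField R := by
  rw [isField_iff_maximalIdeal_eq,
    ← Submodule.spanFinrank_eq_zero_iff_eq_bot (IsNoetherian.noetherian _)]
  have := IsRegularLocalRing.spanFinrank_maximalIdeal (R := R)
  rw [h] at this
  exact_mod_cast this

/-- Cutting a regular local ring by an element `x` outside the square of the maximal ideal gives a
regular local ring of dimension one less: `x` is part of a minimal system of generators of the
maximal ideal. -/
lemma IsRegularLocalRing.quotient_span_singleton {R : Type*} [CommRing R] [IsRegularLocalRing R]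
    {n : ℕ} (hn : ringKrullDim R = (n + 1 : ℕ)) {x : R} (hx : x ∈ maximalIdeal R)
    (hx2 : x ∉ maximalIdeal R ^ 2) :
    IsRegularLocalRing (R ⧸ Ideal.span {x}) ∧ ringKrullDim (R ⧸ Ideal.span {x}) = n := by
  have hne : Ideal.span {x} ≠ ⊤ := fun h => by
    have : Ideal.span {x} ≤ maximalIdeal R := by simpa [Ideal.span_le] using hx
    exact (maximalIdeal.isMaximal R).ne_top (top_le_iff.1 (h ▸ this))
  have : Nontrivial (R ⧸ Ideal.span {x}) := Ideal.Quotient.nontrivial_iff.2 hne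
  have hloc : IsLocalRing (R ⧸ Ideal.span {x}) :=
    .of_surjective' (Ideal.Quotient.mk _) Ideal.Quotient.mk_surjective
  have hlh : IsLocalHom (Ideal.Quotient.mk (Ideal.span {x})) :=
    .of_surjective _ Ideal.Quotient.mk_surjective
  have hr := IsRegularLocalRing.spanFinrank_maximalIdeal (R := R)
  rw [hn] at hr
  have hr' : (maximalIdeal R).spanFinrank = n + 1 := by exact_mod_cast hr
  obtain ⟨s, hsc, hss⟩ := Submodule.FG.exists_span_finset_card_eq_spanFinrank
    (IsNoetherian.noetherian (maximalIdeal R))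
  have hsm : ∀ i ∈ s, i ∈ maximalIdeal R := fun i hi => hss ▸ Submodule.subset_span hi
  have hxs : x ∈ Submodule.span R (s : Set R) := hss ▸ hx
  obtain ⟨f, hf⟩ := Submodule.mem_span_finset'.1 hxs
  obtain ⟨i, hi⟩ : ∃ i : s, IsUnit (f i) := by
    by_contra! h
    refine hx2 (hf ▸ Ideal.sum_mem _ fun i _ => ?_)
    rw [pow_two]
    exact Ideal.mul_mem_mul ((mem_maximalIdeal _).2 (h i)) (hsm i i.2)
  classical
  have hmap : maximalIdeal (R ⧸ Ideal.span {x}) =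
      Ideal.span (Ideal.Quotient.mk (Ideal.span {x}) '' (s.erase i : Finset R)) := by
    apply le_antisymm
    · intro y hy
      obtain ⟨y, rfl⟩ := Ideal.Quotient.mk_surjective y
      have hy' : y ∈ maximalIdeal R := by
        rw [mem_maximalIdeal] at hy ⊢
        exact fun hu => hy (hu.map _)
      rw [← hss] at hy'
      rw [← Ideal.map_span]
      have hle : Submodule.span R (s : Set R) ≤
          (Ideal.map (Ideal.Quotient.mk (Ideal.span {x}))
            (Ideal.span (s.erase i : Finset R))).comap (Ideal.Quotient.mk (Ideal.span {x})) := by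
        rw [Submodule.span_le]
        have hall : ∀ j : s, j ≠ i → (j : R) ∈ (Ideal.map (Ideal.Quotient.mk (Ideal.span {x}))
            (Ideal.span (s.erase i : Finset R))).comap (Ideal.Quotient.mk (Ideal.span {x})) := by
          intro j hj
          refine Ideal.mem_comap.2 (Ideal.mem_map_of_mem _ (Ideal.subset_span ?_))
          simpa using hj
        intro j hj
        by_cases hji : (⟨j, hj⟩ : s) = i
        · subst hji
          rw [← Finset.add_sum_erase _ _ (Finset.mem_univ (⟨j, hj⟩ : s))] at hf
          have h1 : Ideal.Quotient.mk (Ideal.span {x}) x = 0 := by simp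
          rw [congrArg (Ideal.Quotient.mk (Ideal.span {x})) hf.symm, map_add] at h1
          have h2 : ∑ k ∈ Finset.univ.erase (⟨j, hj⟩ : s), f k • (k : R) ∈
              (Ideal.map (Ideal.Quotient.mk (Ideal.span {x}))
            (Ideal.span (s.erase j : Finset R))).comap (Ideal.Quotient.mk (Ideal.span {x})) :=
            Ideal.sum_mem _ fun k hk => Ideal.mul_mem_left _ _ (hall k (Finset.ne_of_mem_erase hk))
          have h3 : f ⟨j, hj⟩ • j ∈ (Ideal.map (Ideal.Quotient.mk (Ideal.span {x}))
            (Ideal.span (s.erase j : Finset R))).comap (Ideal.Quotient.mk (Ideal.span {x})) := by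
            rw [Ideal.mem_comap, eq_neg_of_add_eq_zero_left h1]
            exact neg_mem h2
          exact (Ideal.unit_mul_mem_iff_mem _ hi).1 h3
        · exact hall _ hji
      exact hle hy'
    · rw [Ideal.span_le]
      rintro _ ⟨j, hj, rfl⟩
      have := hsm j (Finset.mem_of_mem_erase hj)
      simp only [SetLike.mem_coe, mem_maximalIdeal] at this ⊢
      exact fun hu => this (isUnit_of_map_unit _ _ hu)
  have hle : (maximalIdeal (R ⧸ Ideal.span {x})).spanFinrank ≤ n := by
    rw [hmap]
    have hfin := (s.erase (i : R)).finite_toSet.image (Ideal.Quotient.mk (Ideal.span {x}))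
    refine (Submodule.spanFinrank_span_le_ncard_of_finite hfin).trans ?_
    refine (Set.ncard_image_le (Finset.finite_toSet _)).trans ?_
    rw [Set.ncard_coe_finset, Finset.card_erase_of_mem i.2, hsc, hr']
    simp
  have hdim : ((n : ℕ) : WithBot ℕ∞) ≤ ringKrullDim (R ⧸ Ideal.span {x}) := by
    have := ringKrullDim_le_ringKrullDim_quotient_add_card (R := R) {x}
      (by simpa [IsLocalRing.ringJacobson_eq_maximalIdeal] using hx)
    rw [hn, Finset.card_singleton, Finset.coe_singleton, Nat.cast_add] at this
    exact ENat.WithBot.add_le_add_one_right_iff.1 this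
  have hle' : ((maximalIdeal (R ⧸ Ideal.span {x})).spanFinrank : WithBot ℕ∞) ≤ n := by
    exact_mod_cast hle
  have hreg := IsRegularLocalRing.of_spanFinrank_maximalIdeal_le (R ⧸ Ideal.span {x})
    (hle'.trans hdim)
  exact ⟨hreg, le_antisymm (hreg.spanFinrank_maximalIdeal ▸ hle') hdim⟩

/-- Prime avoidance: in a regular local ring of positive dimension, some element of the maximal
ideal lies neither in its square nor in a minimal prime. -/
lemma IsRegularLocalRing.exists_mem_maximalIdeal {R : Type*} [CommRing R] [IsRegularLocalRing R]
    (hn : ringKrullDim R ≠ 0) : ∃ x ∈ maximalIdeal R, x ∉ maximalIdeal R ^ 2 ∧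
      ∀ p ∈ minimalPrimes R, x ∉ p := by
  classical
  by_contra! h
  have hfin := minimalPrimes.finite_of_isNoetherianRing R
  have hcov : (maximalIdeal R : Set R) ⊆
      ⋃ p ∈ (↑(insert (maximalIdeal R ^ 2) hfin.toFinset) : Set (Ideal R)), (id p : Ideal R) := by
    intro x hx
    by_cases hx2 : x ∈ maximalIdeal R ^ 2
    · exact Set.mem_biUnion (Finset.mem_coe.2 (Finset.mem_insert_self _ _)) hx2
    · obtain ⟨p, hp, hxp⟩ := h x hx hx2
      exact Set.mem_biUnion (Finset.mem_coe.2 (Finset.mem_insert_of_mem (by simpa using hp))) hxp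
  obtain ⟨p, hp, hle⟩ := (Ideal.subset_union_prime (maximalIdeal R ^ 2) (maximalIdeal R ^ 2)
    (fun i hi h1 _ => by
      rcases Finset.mem_insert.1 hi with rfl | hi
      · exact absurd rfl h1
      · exact ((Set.Finite.mem_toFinset _).1 hi).1.1)).1 hcov
  rcases Finset.mem_insert.1 hp with rfl | hp
  · exact (IsLocalRing.maximalIdeal_sq_lt_of_ringKrullDim_ne_zero hn).not_ge hle
  · have hp := (Set.Finite.mem_toFinset _).1 hp
    have hpp : p.IsPrime := hp.1.1
    have : p = maximalIdeal R := le_antisymm (le_maximalIdeal hpp.ne_top) hle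
    subst this
    apply hn
    rw [← IsLocalRing.maximalIdeal_height_eq_ringKrullDim, Ideal.height_eq_zero_iff.2 hp]
    rfl

/-- A regular local ring is a domain. -/
lemma IsRegularLocalRing.isDomain_of_ringKrullDim_eq (n : ℕ) :
    ∀ (R : Type u) [CommRing R] [IsRegularLocalRing R], ringKrullDim R = n → IsDomain R := by
  induction n with
  | zero =>
    intro R _ _ h
    exact (IsRegularLocalRing.isField_of_ringKrullDim_eq_zero (by simpa using h)).isDomain
  | succ n ih =>
    intro R _ _ h
    obtain ⟨x, hx, hx2, hxp⟩ := IsRegularLocalRing.exists_mem_maximalIdeal (R := R) (by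
      rw [h]; exact_mod_cast (Nat.succ_ne_zero n))
    obtain ⟨hreg, hdim⟩ := IsRegularLocalRing.quotient_span_singleton h hx hx2
    have hdom := ih (R ⧸ Ideal.span {x}) hdim
    have hprime : (Ideal.span {x}).IsPrime := (Ideal.Quotient.isDomain_iff_prime _).1 hdom
    obtain ⟨q, hq, hqx⟩ := Ideal.exists_minimalPrimes_le (bot_le : ⊥ ≤ Ideal.span {x})
    have hqp : q.IsPrime := hq.1.1
    have hxq := hxp q hq
    have hbot : q = ⊥ := by
      refine Submodule.eq_bot_of_le_smul_of_le_jacobson_bot (Ideal.span {x}) q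
        (IsNoetherian.noetherian q) (fun y hy => ?_) ?_
      · obtain ⟨a, rfl⟩ := Ideal.mem_span_singleton'.1 (hqx hy)
        rw [mul_comm]
        exact Ideal.mul_mem_mul (Ideal.mem_span_singleton_self x)
          ((hqp.mem_or_mem hy).resolve_right hxq)
      · rw [IsLocalRing.jacobson_eq_maximalIdeal _ bot_ne_top]
        simpa [Ideal.span_le] using hx
    have : (⊥ : Ideal R).IsPrime := hbot ▸ hqp
    exact IsDomain.of_bot_isPrime R

/-- A regular local ring of positive dimension has a nonzero element whose quotient is again
regular local, of dimension one less. -/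
lemma IsRegularLocalRing.exists_isSMulRegular {R : Type*} [CommRing R]
    [IsRegularLocalRing R] {n : ℕ} (h : ringKrullDim R = (n + 1 : ℕ)) :
    ∃ x ∈ maximalIdeal R, x ≠ 0 ∧ IsRegularLocalRing (R ⧸ Ideal.span {x}) ∧
      ringKrullDim (R ⧸ Ideal.span {x}) = n := by
  obtain ⟨x, hx, hx2, hxp⟩ := IsRegularLocalRing.exists_mem_maximalIdeal (R := R) (by
      rw [h]; exact_mod_cast (Nat.succ_ne_zero n))
  obtain ⟨hreg, hdim⟩ := IsRegularLocalRing.quotient_span_singleton h hx hx2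
  exact ⟨x, hx, fun h0 => hx2 (h0 ▸ zero_mem _), hreg, hdim⟩

/-- A regular local ring has a regular sequence whose length is its dimension. -/
lemma IsRegularLocalRing.exists_isRegular (n : ℕ) :
    ∀ (R : Type u) [CommRing R] [IsRegularLocalRing R], ringKrullDim R = n →
      ∃ rs : List R, IsRegular R rs ∧ rs.length = n := by
  induction n with
  | zero => exact fun R _ _ _ => ⟨[], IsRegular.nil R R, rfl⟩
  | succ n ih =>
    intro R _ _ h
    have := IsRegularLocalRing.isDomain_of_ringKrullDim_eq _ R h
    obtain ⟨x, hx, hx0, hreg, hdim⟩ := IsRegularLocalRing.exists_isSMulRegular h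
    obtain ⟨rs, hrs, hlen⟩ := ih _ hdim
    obtain ⟨rs', rfl⟩ : ∃ rs' : List R, rs'.map (Ideal.Quotient.mk (Ideal.span {x})) = rs :=
      List.map_surjective_iff.2 Ideal.Quotient.mk_surjective rs
    refine ⟨x :: rs', (isRegular_cons_iff' R x rs').2 ⟨?_, ?_⟩, by simpa using hlen⟩
    · exact IsSMulRegular.of_ne_zero hx0
    · let e : (R ⧸ Ideal.span {x}) ≃ₗ[R] QuotSMulTop x R :=
        Submodule.quotEquivOfEq _ _ (by
          simpa using (Submodule.ideal_span_singleton_smul x (⊤ : Ideal R)))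
      exact (LinearEquiv.isRegular_congr
        (e.extendScalarsOfSurjective Ideal.Quotient.mk_surjective) _).1 hrs

end RegularLocal

section GlobalDimension

open CategoryTheory IsLocalRing

/-- Let `x` be a non-unit of a noetherian local ring `R`, regular on the finite module `K`. The
projective dimension of `K` over `R` is at most that of `K / x K` over `R / x`: a resolution of
`K / x K` can be lifted step by step. -/
lemma hasProjectiveDimensionLE_of_quotSMulTop {R : Type u} [CommRing R] [IsLocalRing R]
    [IsNoetherianRing R] {x : R} (hx : x ∈ maximalIdeal R) (hxR : IsSMulRegular R x) (n : ℕ) :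
    ∀ (K : Type u) [AddCommGroup K] [Module R K] [Module.Finite R K], IsSMulRegular K x →
      HasProjectiveDimensionLE (ModuleCat.of (R ⧸ Ideal.span {x}) (QuotSMulTop x K)) n →
      HasProjectiveDimensionLE (ModuleCat.of R K) n := by
  have hne : Ideal.span {x} ≠ ⊤ := fun h => by
    have : Ideal.span {x} ≤ maximalIdeal R := by simpa [Ideal.span_le] using hx
    exact (maximalIdeal.isMaximal R).ne_top (top_le_iff.1 (h ▸ this))
  have : Nontrivial (R ⧸ Ideal.span {x}) := Ideal.Quotient.nontrivial_iff.2 hne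
  have hloc : IsLocalRing (R ⧸ Ideal.span {x}) :=
    .of_surjective' (Ideal.Quotient.mk _) Ideal.Quotient.mk_surjective
  induction n with
  | zero =>
    intro K _ _ _ hK h
    rw [← projective_iff_hasProjectiveDimensionLE_zero, ← IsProjective.iff_projective] at h ⊢
    have hfin : Module.Finite (R ⧸ Ideal.span {x}) (QuotSMulTop x K) :=
      Module.Finite.of_restrictScalars_finite R _ _
    have hfree : Module.Free (R ⧸ Ideal.span {x}) (QuotSMulTop x K) :=
      Module.free_of_flat_of_isLocalRing
    have : Module.FinitePresentation R K := Module.finitePresentation_of_finite R K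
    have := (Module.free_quotSMulTop_iff_free R K
      (by rwa [IsLocalRing.jacobson_eq_maximalIdeal _ bot_ne_top]) hK).1 hfree
    exact Module.Projective.of_free
  | succ n ih =>
    intro K _ _ _ hK h
    obtain ⟨P, _, _, _, _, f, hf⟩ := Module.exists_finite_presentation R K
    have hP : IsSMulRegular P x := by
      rw [(Module.Free.chooseBasis R P).repr.isSMulRegular_congr]
      exact fun a b h => Finsupp.ext fun i => hxR (DFunLike.congr_fun h i)
    let S := f.shortComplexKer
    have hS : S.ShortExact := LinearMap.shortExact_shortComplexKer hf
    have hSp : Projective S.X₂ := by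
      rw [← IsProjective.iff_projective]; exact Module.Projective.of_free
    have hL : IsSMulRegular f.ker x := hP.submodule _ _
    refine (hS.hasProjectiveDimensionLT_X₃_iff n hSp).2 (ih f.ker hL ?_)
    let i' : QuotSMulTop x f.ker →ₗ[R ⧸ Ideal.span {x}] QuotSMulTop x P :=
      (QuotSMulTop.map x f.ker.subtype).extendScalarsOfSurjective Ideal.Quotient.mk_surjective
    let f' : QuotSMulTop x P →ₗ[R ⧸ Ideal.span {x}] QuotSMulTop x K :=
      (QuotSMulTop.map x f).extendScalarsOfSurjective Ideal.Quotient.mk_surjective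
    have hex : Function.Exact i' f' :=
      QuotSMulTop.map_exact x (LinearMap.exact_subtype_ker_map f) hf
    have hsur : Function.Surjective f' := QuotSMulTop.map_surjective x hf
    have hinj : Function.Injective i' := by
      rw [injective_iff_map_eq_zero]
      intro z hz
      obtain ⟨⟨z, hzf⟩, rfl⟩ := Submodule.Quotient.mk_surjective _ z
      have hz' : (Submodule.Quotient.mk z : QuotSMulTop x P) = 0 := hz
      rw [Submodule.Quotient.mk_eq_zero, Submodule.mem_smul_pointwise_iff_exists] at hz'
      obtain ⟨p, -, rfl⟩ := hz'
      have hp : f p = 0 := by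
        refine hK.right_eq_zero_of_smul ?_
        rw [← map_smul]
        exact hzf
      rw [Submodule.Quotient.mk_eq_zero, Submodule.mem_smul_pointwise_iff_exists]
      exact ⟨⟨p, hp⟩, trivial, rfl⟩
    let S' : ShortComplex (ModuleCat.{u} (R ⧸ Ideal.span {x})) :=
      ModuleCat.shortComplexOfCompEqZero i' f' hex.linearMap_comp_eq_zero
    have hS' : S'.ShortExact := ModuleCat.shortComplex_shortExact S' hex hinj hsur
    have hSp' : Projective S'.X₂ := by
      rw [← IsProjective.iff_projective]
      exact (inferInstance : Module.Projective (R ⧸ Ideal.span {x}) (QuotSMulTop x P))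
    exact (hS'.hasProjectiveDimensionLT_X₃_iff n hSp').1 h

/-- A finite module over a regular local ring of dimension `n` has projective dimension at most
`n`. -/
lemma IsRegularLocalRing.hasProjectiveDimensionLE (n : ℕ) :
    ∀ (R : Type u) [CommRing R] [IsRegularLocalRing R], ringKrullDim R = n →
      ∀ (M : Type u) [AddCommGroup M] [Module R M] [Module.Finite R M],
        HasProjectiveDimensionLE (ModuleCat.of R M) n := by
  induction n with
  | zero =>
    intro R _ _ h M _ _ _
    let := (IsRegularLocalRing.isField_of_ringKrullDim_eq_zero (R := R)
      (by simpa using h)).toField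
    rw [← projective_iff_hasProjectiveDimensionLE_zero, ← IsProjective.iff_projective]
    exact Module.Projective.of_free
  | succ n ih =>
    intro R _ _ h M _ _ _
    have := IsRegularLocalRing.isDomain_of_ringKrullDim_eq _ R h
    obtain ⟨x, hx, hx0, hreg, hdim⟩ := IsRegularLocalRing.exists_isSMulRegular h
    obtain ⟨P, _, _, _, _, f, hf⟩ := Module.exists_finite_presentation R M
    have hP : IsSMulRegular P x := IsSMulRegular.of_ne_zero hx0
    have hS := LinearMap.shortExact_shortComplexKer hf
    have hSp : Projective (f.shortComplexKer).X₂ := by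
      rw [← IsProjective.iff_projective]; exact Module.Projective.of_free
    refine (hS.hasProjectiveDimensionLT_X₃_iff n hSp).2
      (hasProjectiveDimensionLE_of_quotSMulTop hx (IsSMulRegular.of_ne_zero hx0) n f.ker
        (hP.submodule _ _) ?_)
    have hfin : Module.Finite (R ⧸ Ideal.span {x}) (QuotSMulTop x f.ker) :=
      Module.Finite.of_restrictScalars_finite R _ _
    exact ih _ hdim _

/-- Auslander: if all finite modules have projective dimension at most `n`, then all modules do. By
Baer's criterion every module has injective dimension at most `n`. -/
lemma hasInjectiveDimensionLE_of_forall_finite {R : Type u} [CommRing R] (n : ℕ) :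
    ∀ (N : ModuleCat.{u} R),
      (∀ (M : ModuleCat.{u} R) [Module.Finite R M] (e : Abelian.Ext M N (n + 1)), e = 0) →
      HasInjectiveDimensionLE N n := by
  induction n with
  | zero =>
    intro N h
    have : Injective N := by
      rw [← Module.injective_iff_injective_object R N]
      refine Module.Baer.injective fun I g => ?_
      have hI : Function.Surjective I.mkQ := I.mkQ_surjective
      let S : ShortComplex (ModuleCat.{u} R) :=
        ModuleCat.shortComplexOfCompEqZero I.subtype I.mkQ
          (LinearMap.exact_subtype_mkQ I).linearMap_comp_eq_zero
      have hS : S.ShortExact := ModuleCat.shortComplex_shortExact S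
        (LinearMap.exact_subtype_mkQ I) I.injective_subtype hI
      obtain ⟨y, hy⟩ := Abelian.Ext.contravariant_sequence_exact₁ hS N
        (Abelian.Ext.mk₀ (ModuleCat.ofHom g)) (add_comm 1 0)
        (h (ModuleCat.of R (R ⧸ I)) _)
      obtain ⟨g', rfl⟩ := (Abelian.Ext.mk₀_bijective _ _).2 y
      rw [Abelian.Ext.mk₀_comp_mk₀] at hy
      have hg := (Abelian.Ext.mk₀_bijective _ _).1 hy
      refine ⟨g'.hom, fun x hx => ?_⟩
      exact congrArg (fun φ => φ.hom ⟨x, hx⟩) hg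
    exact injective_iff_hasInjectiveDimensionLT_one.1 this
  | succ n ih =>
    intro N h
    obtain ⟨p⟩ := EnoughInjectives.presentation N
    let S := ShortComplex.mk _ _ (Limits.cokernel.condition p.f)
    have hS : S.ShortExact := { exact := ShortComplex.exact_cokernel p.f }
    refine (hS.hasInjectiveDimensionLT_X₃_iff n p.injective).1 (ih _ fun M _ e => ?_)
    obtain ⟨y, rfl⟩ := Abelian.Ext.covariant_sequence_exact₃ M hS e rfl (h M _)
    have := p.injective
    rw [Abelian.Ext.eq_zero_of_injective y, Abelian.Ext.zero_comp]

/-- The global dimension of a regular ring of finite Krull dimension is its Krull dimension. -/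
lemma globalDim_eq_ringKrullDim {R : Type v} [CommRing R] [IsRegularRing R] {d : ℕ}
    (hd : ringKrullDim R = d) : globalDim R = d := by
  have : Nontrivial R := by
    by_contra h
    rw [not_nontrivial_iff_subsingleton] at h
    rw [ringKrullDim_eq_bot_of_subsingleton] at hd
    cases hd
  have hfd : FiniteRingKrullDim R := by
    rw [finiteRingKrullDim_iff_ne_bot_and_top, hd]
    exact ⟨by rintro ⟨⟩, fun h => ENat.natCast_ne_top d (WithBot.coe_injective h)⟩
  apply le_antisymm
  · have hfg : ∀ (M : ModuleCat.{v} R) [Module.Finite R M], HasProjectiveDimensionLE M d := by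
      intro M _
      rw [ModuleCat.hasProjectiveDimensionLE_iff_forall_maximalSpectrum]
      intro m
      have hle : (m.1.height : WithBot ℕ∞) ≤ d :=
        hd ▸ Ideal.height_le_ringKrullDim_of_ne_top m.2.ne_top
      obtain ⟨e, he⟩ := ENat.ne_top_iff_exists.1 (Ideal.height_ne_top (I := m.1) m.2.ne_top)
      rw [← he] at hle
      have hle' : e ≤ d := by exact_mod_cast hle
      have hdim : ringKrullDim (Localization.AtPrime m.1) = e := by
        rw [IsLocalization.AtPrime.ringKrullDim_eq_height m.1, ← he]; rfl
      have hfin : Module.Finite (Localization.AtPrime m.1) (M.localizedModule m.1.primeCompl) :=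
        Module.Finite.of_isLocalizedModule m.1.primeCompl
          (M.localizedModuleMkLinearMap m.1.primeCompl)
      have := IsRegularLocalRing.hasProjectiveDimensionLE e (Localization.AtPrime m.1) hdim
        (M.localizedModule m.1.primeCompl)
      exact hasProjectiveDimensionLT_of_ge _ (e + 1) (d + 1) (by lia)
    refine iSup_le fun M => ?_
    rw [projectiveDimension_le_iff]
    refine HasProjectiveDimensionLT.mk fun i hi Y e => ?_
    have := hasInjectiveDimensionLE_of_forall_finite d Y fun M _ e => by
      have := hfg M
      exact e.eq_zero_of_hasProjectiveDimensionLT (d + 1) le_rfl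
    exact e.eq_zero_of_hasInjectiveDimensionLT (d + 1) hi
  · obtain ⟨m, hm, hmd⟩ := Ideal.exists_isMaximal_height (R := R)
    rw [hd] at hmd
    have hdim : ringKrullDim (Localization.AtPrime m) = d := by
      rw [IsLocalization.AtPrime.ringKrullDim_eq_height m, hmd]
    obtain ⟨rs, hrs, hlen⟩ := IsRegularLocalRing.exists_isRegular d _ hdim
    have hpd := ModuleCat.projectiveDimension_quotient_eq_length.{v} rs hrs
    rw [hlen] at hpd
    let Q := Localization.AtPrime m ⧸ Ideal.ofList rs
    have hQ := ModuleCat.projectiveDimension_eq_of_linearEquiv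
      (M := ModuleCat.of (Localization.AtPrime m) Q) (N := ModuleCat.of (Localization.AtPrime m)
        (Shrink.{v} Q)) (Shrink.linearEquiv _ Q).symm
    rw [← hQ] at hpd
    -- `Q` is already local at `m`, so localizing it changes nothing.
    have hloc := isLocalizedModule_id m.primeCompl Q (Localization.AtPrime m)
    have hloc' : IsLocalizedModule m.primeCompl
        ((ModuleCat.of R Q).localizedModuleMkLinearMap m.primeCompl) :=
      ModuleCat.localizedModule_isLocalizedModule _ _
    let e : Q ≃ₗ[Localization.AtPrime m] (ModuleCat.of R Q).localizedModule m.primeCompl :=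
      (IsLocalizedModule.linearEquiv m.primeCompl LinearMap.id
        ((ModuleCat.of R Q).localizedModuleMkLinearMap
          m.primeCompl)).extendScalarsOfIsLocalization m.primeCompl _
    have he := ModuleCat.projectiveDimension_eq_of_linearEquiv
      (M := ModuleCat.of (Localization.AtPrime m) Q) e
    have hle := ModuleCat.projectiveDimension_le_projectiveDimension_of_isLocalizedModule
      m.primeCompl (ModuleCat.of R Q)
    rw [← he] at hle
    exact (hpd.symm.le.trans hle).trans (le_iSup (fun M : ModuleCat.{v} R =>
      projectiveDimension M) (ModuleCat.of R Q))

end GlobalDimension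

/-! ### Poincaré–Birkhoff–Witt for Lie–Rinehart frames -/

section PBW

/-- A frame for a Lie–Rinehart algebra over the `k`-algebra `K`: the anchors `X i` of the basis
elements `e i` and the structure functions of the bracket `⁅e i, e j⁆ = ∑ l, c i j l • e l`. The
laws say that the bracket is alternating, that the anchor is a homomorphism of Lie algebras, and
that the Jacobi identity holds on the basis. -/
structure LieRinehartFrame (k K ι : Type*) [CommRing k] [CommRing K] [Algebra k K]
    [Fintype ι] where
  /-- The anchor of the `i`-th basis element. -/
  X : ι → Derivation k K K
  /-- The structure functions of the bracket. -/
  c : ι → ι → ι → K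
  c_self (i l : ι) : c i i l = 0
  c_swap (i j l : ι) : c i j l = -c j i l
  X_comm (i j : ι) (f : K) : X i (X j f) - X j (X i f) = ∑ l, c i j l * X l f
  jacobi (i j p m : ι) :
    (X i (c j p m) + ∑ l, c j p l * c i l m) + (X j (c p i m) + ∑ l, c p i l * c j l m) +
      (X p (c i j m) + ∑ l, c i j l * c p l m) = 0

namespace LieRinehartFrame

variable {k K ι : Type*} [CommRing k] [CommRing K] [Algebra k K]

/-- The first-order operator on the free module on multisets of indices (the polynomials in the
basis elements) that sends the monomial `s` to `g s` and satisfies the Leibniz rule for the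
derivation `D` of the coefficients. -/
noncomputable def leibnizOp (D : Derivation k K K) (g : Multiset ι → (Multiset ι →₀ K)) :
    (Multiset ι →₀ K) →ₗ[k] (Multiset ι →₀ K) :=
  Finsupp.mapRange.linearMap D.toLinearMap + (Finsupp.linearCombination K g).restrictScalars k

lemma leibnizOp_apply (D : Derivation k K K) (g : Multiset ι → (Multiset ι →₀ K))
    (m : Multiset ι →₀ K) : leibnizOp D g m =
      m.mapRange D D.map_zero + Finsupp.linearCombination K g m := rfl

lemma leibnizOp_smul (D : Derivation k K K) (g : Multiset ι → (Multiset ι →₀ K)) (f : K)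
    (m : Multiset ι →₀ K) : leibnizOp D g (f • m) = D f • m + f • leibnizOp D g m := by
  have : (f • m).mapRange D D.map_zero = D f • m + f • m.mapRange D D.map_zero := by
    ext s
    simp [mul_comm, add_comm]
  rw [leibnizOp_apply, leibnizOp_apply, this, map_smul, smul_add, add_assoc]

lemma leibnizOp_single (D : Derivation k K K) (g : Multiset ι → (Multiset ι →₀ K))
    (s : Multiset ι) : leibnizOp D g (Finsupp.single s 1) = g s := by
  rw [leibnizOp_apply]
  simp

/-- The span of the monomials of degree at most `n`. -/
def degreeLE (K ι : Type*) [CommRing K] (n : ℕ) : Submodule K (Multiset ι →₀ K) :=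
  Finsupp.supported K K {s | s.card ≤ n}

lemma single_mem_degreeLE {s : Multiset ι} {n : ℕ} (h : s.card ≤ n) :
    Finsupp.single s (1 : K) ∈ degreeLE K ι n :=
  Finsupp.single_mem_supported K _ h

lemma degreeLE_mono {m n : ℕ} (h : m ≤ n) : degreeLE K ι m ≤ degreeLE K ι n :=
  Finsupp.supported_mono fun _ hs => le_trans hs h

/-- To prove a property of elements of degree at most `n`, consider monomials and `K`-linear
combinations. -/
lemma degreeLE_induction {n : ℕ} {P : (Multiset ι →₀ K) → Prop}
    (single : ∀ s : Multiset ι, s.card ≤ n → P (Finsupp.single s 1)) (zero : P 0)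
    (add : ∀ x y, P x → P y → P (x + y)) (smul : ∀ (f : K) x, P x → P (f • x))
    {w : Multiset ι →₀ K} (hw : w ∈ degreeLE K ι n) : P w := by
  rw [degreeLE, Finsupp.supported_eq_span_single] at hw
  induction hw using Submodule.span_induction with
  | mem x hx => obtain ⟨s, hs, rfl⟩ := hx; exact single s hs
  | zero => exact zero
  | add x y _ _ hx hy => exact add x y hx hy
  | smul f x _ hx => exact smul f x hx

variable [Fintype ι] [LinearOrder ι] (F : LieRinehartFrame k K ι)

/-- The action of basis elements on monomials, correct up to degree `n`; the bound makes the
recursion structural, because the correction terms are acted upon again, in lower degree. On a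
monomial `s` with smallest index `j < i`, written `s = e j * r`, the value is forced by
`e i * e j = e j * e i + ⁅e i, e j⁆`. -/
noncomputable def actAux : ℕ → ι → Multiset ι → (Multiset ι →₀ K)
  | 0, i, s => Finsupp.single (i ::ₘ s) 1
  | n + 1, i, s =>
    if s.card ≤ n then actAux n i s else
      match s.sort (· ≤ ·) with
      | [] => Finsupp.single (i ::ₘ s) 1
      | j :: r => if i ≤ j then Finsupp.single (i ::ₘ s) 1 else
          Finsupp.single (i ::ₘ s) 1 + leibnizOp (F.X j) (actAux n j)
            (actAux n i r - Finsupp.single (i ::ₘ (r : Multiset ι)) 1) +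
            ∑ l, F.c i j l • actAux n l r

/-- The operator by which the basis element `e i` acts on polynomials in the basis elements. -/
noncomputable def act (i : ι) : (Multiset ι →₀ K) →ₗ[k] (Multiset ι →₀ K) :=
  leibnizOp (F.X i) fun s => F.actAux s.card i s

lemma act_smul (i : ι) (f : K) (m : Multiset ι →₀ K) :
    F.act i (f • m) = F.X i f • m + f • F.act i m :=
  leibnizOp_smul _ _ _ _

lemma act_single (i : ι) (s : Multiset ι) :
    F.act i (Finsupp.single s 1) = F.actAux s.card i s :=
  leibnizOp_single _ _ _

lemma actAux_eq {n : ℕ} {s : Multiset ι} (h : s.card ≤ n) (i : ι) :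
    F.actAux n i s = F.act i (Finsupp.single s 1) := by
  induction n with
  | zero => rw [act_single, Nat.le_zero.1 h]
  | succ n ih =>
    rcases Nat.lt_or_ge n s.card with h' | h'
    · rw [act_single, le_antisymm h h']
    · rw [actAux, if_pos h', ih h']

lemma act_single_of_le {i : ι} {s : Multiset ι} (h : ∀ j ∈ s, i ≤ j) :
    F.act i (Finsupp.single s 1) = Finsupp.single (i ::ₘ s) 1 := by
  rw [act_single]
  rcases hs : s.card with _ | n
  · rw [actAux]
  · rw [actAux, if_neg (by lia)]
    split
    · rfl
    · next j r hr =>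
      have : j ∈ s := by rw [← Multiset.mem_sort (· ≤ ·), hr]; simp
      rw [if_pos (h j this)]

lemma leibnizOp_actAux_eq {n : ℕ} (j : ι) {w : Multiset ι →₀ K} (hw : w ∈ degreeLE K ι n) :
    leibnizOp (F.X j) (F.actAux n j) w = F.act j w := by
  refine degreeLE_induction (P := fun w => leibnizOp (F.X j) (F.actAux n j) w = F.act j w)
    (fun s hs => ?_) ?_ (fun x y hx hy => ?_) (fun f x hx => ?_) hw
  · rw [leibnizOp_single, F.actAux_eq hs]
  · simp
  · rw [map_add, map_add, hx, hy]
  · rw [leibnizOp_smul, act_smul, hx]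

lemma act_single_cons_aux {i j : ι} {r : Multiset ι} (hj : ∀ l ∈ r, j ≤ l) (hij : j < i)
    (hr : F.act i (Finsupp.single r 1) - Finsupp.single (i ::ₘ r) 1 ∈ degreeLE K ι r.card) :
    F.act i (Finsupp.single (j ::ₘ r) 1) = Finsupp.single (i ::ₘ j ::ₘ r) 1 +
      F.act j (F.act i (Finsupp.single r 1) - Finsupp.single (i ::ₘ r) 1) +
      ∑ l, F.c i j l • F.act l (Finsupp.single r 1) := by
  rw [act_single, Multiset.card_cons, actAux, if_neg (by simp), Multiset.sort_cons _ _ _ hj]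
  simp only [Multiset.sort_eq, if_neg hij.not_ge, F.actAux_eq le_rfl]
  rw [F.leibnizOp_actAux_eq j hr]

lemma act_mem_degreeLE {n : ℕ}
    (h : ∀ s : Multiset ι, s.card ≤ n → ∀ i, F.act i (Finsupp.single s 1) -
      Finsupp.single (i ::ₘ s) 1 ∈ degreeLE K ι s.card)
    {w : Multiset ι →₀ K} (hw : w ∈ degreeLE K ι n) (j : ι) : F.act j w ∈ degreeLE K ι (n + 1) := by
  refine (degreeLE_induction (P := fun w => w ∈ degreeLE K ι (n + 1) ∧
    F.act j w ∈ degreeLE K ι (n + 1)) (fun s hs => ⟨single_mem_degreeLE (by lia), ?_⟩) (by simp)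
    (fun x y hx hy => ⟨add_mem hx.1 hy.1, by rw [map_add]; exact add_mem hx.2 hy.2⟩)
    (fun f x hx => ⟨Submodule.smul_mem _ _ hx.1, ?_⟩) hw).2
  · have h1 := degreeLE_mono (by lia : s.card ≤ n + 1) (h s hs j)
    have h2 : Finsupp.single (j ::ₘ s) (1 : K) ∈ degreeLE K ι (n + 1) :=
      single_mem_degreeLE (by simpa using hs)
    simpa using add_mem h1 h2
  · rw [act_smul]
    exact add_mem (Submodule.smul_mem _ _ hx.1) (Submodule.smul_mem _ _ hx.2)

omit [Fintype ι] in
lemma _root_.Multiset.forall_le_or_exists_cons (i : ι) (s : Multiset ι) :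
    (∀ j ∈ s, i ≤ j) ∨ ∃ j r, s = j ::ₘ r ∧ j < i ∧ ∀ l ∈ r, j ≤ l := by
  classical
  by_cases h : ∀ j ∈ s, i ≤ j
  · exact .inl h
  · right
    push Not at h
    obtain ⟨a, ha, hai⟩ := h
    obtain ⟨j, hj, hmin⟩ := Finset.exists_min_image s.toFinset id ⟨a, by simpa using ha⟩
    simp only [Multiset.mem_toFinset, id_eq] at hj hmin
    exact ⟨j, s.erase j, (Multiset.cons_erase hj).symm, (hmin a ha).trans_lt hai,
      fun l hl => hmin l (Multiset.mem_of_mem_erase hl)⟩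

/-- The operator `e i` acts on monomials as multiplication by `e i`, up to lower order. -/
lemma act_single_sub_mem (n : ℕ) : ∀ s : Multiset ι, s.card ≤ n → ∀ i,
    F.act i (Finsupp.single s 1) - Finsupp.single (i ::ₘ s) 1 ∈ degreeLE K ι s.card := by
  induction n with
  | zero =>
    intro s hs i
    obtain rfl := Multiset.card_eq_zero.1 (Nat.le_zero.1 hs)
    rw [F.act_single_of_le (by simp), sub_self]
    exact zero_mem _
  | succ n ih =>
    intro s hs i
    rcases Multiset.forall_le_or_exists_cons i s with h | ⟨j, r, rfl, hji, hj⟩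
    · rw [F.act_single_of_le h, sub_self]
      exact zero_mem _
    · have hr : r.card ≤ n := by simpa using hs
      have ih' : ∀ s : Multiset ι, s.card ≤ r.card → ∀ i, F.act i (Finsupp.single s 1) -
        Finsupp.single (i ::ₘ s) 1 ∈ degreeLE K ι s.card := fun s hs => ih s (hs.trans hr)
      rw [F.act_single_cons_aux hj hji (ih r hr i), add_assoc, add_sub_cancel_left,
        Multiset.card_cons]
      refine add_mem (F.act_mem_degreeLE ih' (ih r hr i) j) (sum_mem fun l _ =>
        Submodule.smul_mem _ _ (F.act_mem_degreeLE ih' (single_mem_degreeLE le_rfl) l))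

/-- The action of the bracket `⁅e i, e j⁆`. -/
noncomputable def actBracket (i j : ι) (m : Multiset ι →₀ K) : Multiset ι →₀ K :=
  ∑ l, F.c i j l • F.act l m

/-- The commutator relation, for a monomial all of whose indices are at least the smaller index. -/
lemma act_comm_of_le {i j : ι} {s : Multiset ι} (hji : j < i) (hj : ∀ l ∈ s, j ≤ l) :
    F.act i (F.act j (Finsupp.single s 1)) =
      F.act j (F.act i (Finsupp.single s 1)) + F.actBracket i j (Finsupp.single s 1) := by
  rw [F.act_single_of_le hj, F.act_single_cons_aux hj hji (F.act_single_sub_mem _ s le_rfl i),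
    map_sub, F.act_single_of_le (i := j) (s := i ::ₘ s) (by simpa using ⟨hji.le, hj⟩),
    Multiset.cons_swap i j, add_sub_cancel, actBracket]

lemma act_comm_of_mem_degreeLE {n : ℕ} {i j : ι}
    (h : ∀ s : Multiset ι, s.card ≤ n → F.act i (F.act j (Finsupp.single s 1)) =
      F.act j (F.act i (Finsupp.single s 1)) + F.actBracket i j (Finsupp.single s 1))
    {w : Multiset ι →₀ K} (hw : w ∈ degreeLE K ι n) :
    F.act i (F.act j w) = F.act j (F.act i w) + F.actBracket i j w := by
  refine degreeLE_induction (P := fun w => F.act i (F.act j w) = F.act j (F.act i w) +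
    F.actBracket i j w) h (by simp [actBracket]) (fun x y hx hy => ?_) (fun f x hx => ?_) hw
  · simp only [map_add, hx, hy, actBracket, smul_add, Finset.sum_add_distrib]
    abel
  · have h1 : F.actBracket i j (f • x) =
        (∑ l, F.c i j l * F.X l f) • x + f • F.actBracket i j x := by
      simp only [actBracket, act_smul, smul_add, Finset.sum_add_distrib, Finset.sum_smul,
        Finset.smul_sum, smul_smul]
      simp only [mul_comm]
    rw [h1, ← F.X_comm]
    simp only [act_smul, map_add, hx, smul_add, sub_smul]
    abel

/-- The coefficients of the iterated bracket `⁅e a, ⁅e b, e c⁆⁆`. -/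
noncomputable def bracketBracket (a b c m : ι) : K :=
  F.X a (F.c b c m) + ∑ l, F.c b c l * F.c a l m

/-- The commutator of `e a` with `⁅e b, e c⁆`. -/
lemma act_actBracket {a b c : ι} {m : Multiset ι →₀ K}
    (h : ∀ l, F.act a (F.act l m) = F.act l (F.act a m) + F.actBracket a l m) :
    F.act a (F.actBracket b c m) =
      F.actBracket b c (F.act a m) + ∑ l, F.bracketBracket a b c l • F.act l m := by
  have h1 : ∑ l, F.bracketBracket a b c l • F.act l m =
      ∑ l, F.X a (F.c b c l) • F.act l m + ∑ l, F.c b c l • F.actBracket a l m := by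
    simp only [bracketBracket, actBracket, add_smul, Finset.sum_add_distrib, Finset.sum_smul,
      Finset.smul_sum, smul_smul]
    rw [Finset.sum_comm]
  rw [h1]
  simp only [actBracket, map_sum, act_smul, h, smul_add, Finset.sum_add_distrib]
  abel

lemma actBracket_self (i : ι) (m : Multiset ι →₀ K) : F.actBracket i i m = 0 := by
  simp [actBracket, F.c_self]

lemma actBracket_swap (i j : ι) (m : Multiset ι →₀ K) :
    F.actBracket i j m = -F.actBracket j i m := by
  simp only [actBracket, F.c_swap i j, neg_smul, Finset.sum_neg_distrib]

/-- The commutator relation on monomials, by induction on the degree. If both indices exceed the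
smallest index `p` of the monomial, then `e p` is moved to the left past both of them, and the
correction terms cancel by the Jacobi identity. -/
lemma act_comm_single (n : ℕ) : ∀ s : Multiset ι, s.card ≤ n → ∀ i j,
    F.act i (F.act j (Finsupp.single s 1)) =
      F.act j (F.act i (Finsupp.single s 1)) + F.actBracket i j (Finsupp.single s 1) := by
  induction n with
  | zero =>
    intro s hs i j
    obtain rfl := Multiset.card_eq_zero.1 (Nat.le_zero.1 hs)
    rcases lt_trichotomy j i with h | rfl | h
    · exact F.act_comm_of_le h (by simp)
    · rw [actBracket_self, add_zero]
    · rw [F.act_comm_of_le h (by simp), F.actBracket_swap i j]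
      abel
  | succ n ih =>
    intro s hs i j
    wlog hji : j < i generalizing i j
    · rcases (not_lt.1 hji).eq_or_lt with rfl | h
      · rw [actBracket_self, add_zero]
      · rw [this j i h, F.actBracket_swap i j]
        abel
    rcases Multiset.forall_le_or_exists_cons j s with h | ⟨p, r, rfl, hpj, hp⟩
    · exact F.act_comm_of_le hji h
    have hr : r.card ≤ n := by simpa using hs
    have hm : Finsupp.single (p ::ₘ r) (1 : K) = F.act p (Finsupp.single r 1) :=
      (F.act_single_of_le hp).symm
    -- Moving `e p` to the left past two basis elements `e a`, `e b`.
    have key : ∀ a b, p < a → p < b → F.act a (F.act b (F.act p (Finsupp.single r 1))) =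
        F.act p (F.act a (F.act b (Finsupp.single r 1))) +
          F.actBracket a p (F.act b (Finsupp.single r 1)) +
          F.actBracket b p (F.act a (Finsupp.single r 1)) +
          ∑ l, F.bracketBracket a b p l • F.act l (Finsupp.single r 1) := by
      intro a b ha hb
      have h1 : F.act a (F.act p (F.act b (Finsupp.single r 1))) =
          F.act p (F.act a (F.act b (Finsupp.single r 1))) +
            F.actBracket a p (F.act b (Finsupp.single r 1)) := by
        have hw := F.act_comm_of_mem_degreeLE (i := a) (j := p) (n := r.card)
          (fun s hs => ih s (hs.trans hr) a p) (F.act_single_sub_mem _ r le_rfl b)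
        have hc := F.act_comm_of_le (s := b ::ₘ r) ha (by simpa using ⟨hb.le, hp⟩)
        have hadd : ∀ x y, F.actBracket a p (x - y) = F.actBracket a p x - F.actBracket a p y :=
          fun x y => by simp [actBracket, smul_sub]
        simp only [map_sub, hc, hadd] at hw
        rw [sub_eq_iff_eq_add] at hw
        rw [hw]
        abel
      rw [ih r hr b p, map_add, h1, F.act_actBracket (fun l => ih r hr a l), add_assoc, add_assoc,
        add_assoc]
    have hE := F.act_actBracket (a := p) (b := i) (c := j) (m := Finsupp.single r 1)
      (fun l => ih r hr p l)
    have hij := ih r hr i j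
    have hJ : ∑ l, F.bracketBracket i j p l • F.act l (Finsupp.single r 1) +
        ∑ l, F.bracketBracket p i j l • F.act l (Finsupp.single r 1) =
        ∑ l, F.bracketBracket j i p l • F.act l (Finsupp.single r 1) := by
      rw [← Finset.sum_add_distrib]
      refine Finset.sum_congr rfl fun l _ => ?_
      rw [← add_smul]
      congr 1
      have h1 := F.jacobi i j p l
      have h2 : F.bracketBracket j i p l = -(F.X j (F.c p i l) + ∑ q, F.c p i q * F.c j q l) := by
        simp only [bracketBracket, F.c_swap i p, map_neg, neg_mul, Finset.sum_neg_distrib]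
        ring
      rw [h2]
      simp only [bracketBracket]
      linear_combination h1
    rw [hm, key i j (hpj.trans hji) hpj, key j i hpj (hpj.trans hji), hij, map_add, hE, ← hJ]
    abel

/-- The operators `act i` form a representation of the Lie–Rinehart algebra. -/
theorem act_comm (i j : ι) (m : Multiset ι →₀ K) :
    F.act i (F.act j m) = F.act j (F.act i m) + ∑ l, F.c i j l • F.act l m := by
  induction m using Finsupp.induction_linear with
  | zero => simp
  | add x y hx hy =>
    simp only [map_add, hx, hy, smul_add, Finset.sum_add_distrib]
    abel
  | single s f =>
    have hs : Finsupp.single s f ∈ degreeLE K ι s.card :=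
      Finsupp.single_mem_supported K f (le_refl s.card)
    exact F.act_comm_of_mem_degreeLE (fun s hs => F.act_comm_single _ s hs i j) hs

/-- Acting on the empty monomial, ordered products of basis elements give all monomials. -/
lemma prod_map_act_single_zero (l : List ι) (hl : l.Pairwise (· ≤ ·)) :
    (l.map F.act).prod (Finsupp.single 0 1) = Finsupp.single (l : Multiset ι) 1 := by
  induction l with
  | nil => rfl
  | cons i l ih =>
    rw [List.pairwise_cons] at hl
    rw [List.map_cons, List.prod_cons, Module.End.mul_apply, ih hl.2,
      F.act_single_of_le (by simpa using hl.1), Multiset.cons_coe]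

end LieRinehartFrame

end PBW

/-! ### The enveloping algebra acting on polynomials in the frame -/

lemma Derivation.finset_sum_apply {R A M ι : Type*} [CommSemiring R] [CommSemiring A]
    [AddCommMonoid M] [Algebra R A] [Module A M] [Module R M] (s : Finset ι)
    (D : ι → Derivation R A M) (a : A) : (∑ i ∈ s, D i) a = ∑ i ∈ s, D i a := by
  rw [← Derivation.coeFnAddMonoidHom_apply, map_sum, Finset.sum_apply]
  rfl

namespace PoissonAlgebra

variable {k A K ι : Type*} [CommRing k] [CommRing A] [Algebra k A] [PoissonAlgebra k A]

namespace Enveloping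

variable (k A)

/-- The quotient map from the free algebra. -/
noncomputable def mk : TensorAlgebra k (A × A) →ₐ[k] Enveloping k A :=
  RingQuot.mkAlgHom k (EnvelopingRel k A)

/-- The generators `h_a`. -/
noncomputable def h : A →ₗ[k] Enveloping k A :=
  (mk k A).toLinearMap ∘ₗ TensorAlgebra.ι k ∘ₗ LinearMap.inr k A A

/-- The generators `m_a`, which form a homomorphism of algebras. -/
noncomputable def m : A →ₐ[k] Enveloping k A :=
  AlgHom.ofLinearMap ((mk k A).toLinearMap ∘ₗ TensorAlgebra.ι k ∘ₗ LinearMap.inl k A A)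
    ((RingQuot.mkAlgHom_rel k EnvelopingRel.m_one).trans (map_one (mk k A)))
    fun x y => (RingQuot.mkAlgHom_rel k (EnvelopingRel.m_mul x y)).trans (map_mul (mk k A) _ _)

variable {A}

lemma m_def (a : A) : m k A a = mk k A (freeM k A a) := rfl

lemma h_def (a : A) : h k A a = mk k A (freeH k A a) := rfl

lemma h_bracket (x y : A) : h k A (bracket (k := k) x y) =
    h k A x * h k A y - h k A y * h k A x := by
  simp only [h_def, ← map_mul, ← map_sub]
  exact RingQuot.mkAlgHom_rel k (EnvelopingRel.h_bracket x y)

lemma h_mul (x y : A) : h k A (x * y) = m k A y * h k A x + m k A x * h k A y := by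
  simp only [h_def, m_def, ← map_mul, ← map_add]
  exact RingQuot.mkAlgHom_rel k (EnvelopingRel.h_mul x y)

lemma h_mul_m (x y : A) : h k A x * m k A y =
    m k A y * h k A x + m k A (bracket (k := k) x y) := by
  rw [← sub_eq_iff_eq_add']
  simp only [h_def, m_def, ← map_mul, ← map_sub]
  exact (RingQuot.mkAlgHom_rel k (EnvelopingRel.m_bracket x y)).symm

lemma adjoin_eq_top : Algebra.adjoin k (Set.range (m k A) ∪ Set.range (h k A)) = ⊤ := by
  rw [eq_top_iff]
  rintro x -
  obtain ⟨x, rfl⟩ := RingQuot.mkAlgHom_surjective k (EnvelopingRel k A) x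
  change mk k A x ∈ _
  induction x using TensorAlgebra.induction with
  | algebraMap r =>
    rw [AlgHom.commutes]
    exact Subalgebra.algebraMap_mem _ r
  | ι x =>
    have : TensorAlgebra.ι k x = freeM k A x.1 + freeH k A x.2 := by
      rw [freeM, freeH, ← map_add, Prod.mk_add_mk, add_zero, zero_add]
    rw [this, map_add]
    exact add_mem (Algebra.subset_adjoin (.inl ⟨x.1, rfl⟩))
      (Algebra.subset_adjoin (.inr ⟨x.2, rfl⟩))
  | mul a b ha hb => rw [map_mul]; exact mul_mem ha hb
  | add a b ha hb => rw [map_add]; exact add_mem ha hb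

end Enveloping

lemma bracket_swap (a b : A) : bracket (k := k) a b = -bracket (k := k) b a := by
  have h := bracket_self (k := k) (a + b)
  simp only [map_add, LinearMap.add_apply, bracket_self] at h
  linear_combination h

variable (k) in
/-- The Hamiltonian derivation `{b, -}`. -/
def hamiltonian (b : A) : Derivation k A A :=
  Derivation.mk' (bracket (k := k) b) fun x y => by
    rw [bracket_swap b (x * y), leibniz, bracket_swap b x, bracket_swap b y]
    simp only [smul_eq_mul]
    ring

lemma hamiltonian_apply (b a : A) : hamiltonian k b a = bracket (k := k) b a := rfl

variable [Field K] [Algebra k K] [Algebra A K] [IsScalarTower k A K]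

omit [PoissonAlgebra k A] in
variable (k A K ι) in
/-- Elements `y i` of a Poisson algebra `A` that serve as coordinates for derivations with values in
the field `K` over `A`: there are coordinate derivations `∂ i` of `K`, and derivations of `A` and of
`K` into `K` are determined by their values on the coordinates. -/
structure Coordinates where
  /-- The coordinates. -/
  y : ι → A
  /-- The coordinate derivations. -/
  der : ι → Derivation k K K
  der_y_self (i : ι) : der i (algebraMap A K (y i)) = 1
  der_y_of_ne {i j : ι} (h : i ≠ j) : der i (algebraMap A K (y j)) = 0
  eq_zero (D : Derivation k A K) : (∀ i, D (y i) = 0) → D = 0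
  eq_zero_of_algebraMap (D : Derivation k K K) : (∀ a, D (algebraMap A K a) = 0) → D = 0

namespace Coordinates

variable (C : Coordinates k A K ι)

omit [PoissonAlgebra k A] [IsScalarTower k A K] in
lemma der_y [DecidableEq ι] (i j : ι) :
    C.der i (algebraMap A K (C.y j)) = if i = j then 1 else 0 := by
  split_ifs with h
  · rw [h, der_y_self]
  · exact C.der_y_of_ne h

omit [PoissonAlgebra k A] [IsScalarTower k A K] in
lemma ext_left {D₁ D₂ : Derivation k A K} (h : ∀ i, D₁ (C.y i) = D₂ (C.y i)) : D₁ = D₂ :=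
  sub_eq_zero.1 (C.eq_zero _ fun i => by simp [h i])

omit [PoissonAlgebra k A] in
lemma ext_right {D₁ D₂ : Derivation k K K}
    (h : ∀ i, D₁ (algebraMap A K (C.y i)) = D₂ (algebraMap A K (C.y i))) : D₁ = D₂ := by
  refine sub_eq_zero.1 (C.eq_zero_of_algebraMap _ fun a => ?_)
  have := C.eq_zero ((D₁ - D₂).compAlgebraMap A) fun i => by simp [h i]
  exact DFunLike.congr_fun this a

omit [PoissonAlgebra k A] in
lemma der_comm (i j : ι) (f : K) : C.der i (C.der j f) = C.der j (C.der i f) := by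
  classical
  have : ⁅C.der i, C.der j⁆ = 0 := C.ext_right fun l => by
    rw [Derivation.commutator_apply, C.der_y, C.der_y]
    split_ifs <;> simp
  have := DFunLike.congr_fun this f
  rwa [Derivation.commutator_apply, Derivation.zero_apply, sub_eq_zero] at this

/-- The brackets of the coordinates. -/
def bivector (i j : ι) : K := algebraMap A K (bracket (k := k) (C.y i) (C.y j))

omit [IsScalarTower k A K] in
lemma bivector_swap (i j : ι) : C.bivector i j = -C.bivector j i := by
  rw [bivector, bracket_swap, map_neg, bivector]

omit [IsScalarTower k A K] in
lemma bivector_self (i : ι) : C.bivector i i = 0 := by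
  rw [bivector, bracket_self, map_zero]

variable [Fintype ι]

/-- The extension to `K` of the Hamiltonian derivation of a coordinate. -/
noncomputable def anchor (i : ι) : Derivation k K K := ∑ j, C.bivector i j • C.der j

omit [IsScalarTower k A K] in
lemma anchor_apply (i : ι) (f : K) : C.anchor i f = ∑ j, C.bivector i j * C.der j f := by
  simp [anchor, Derivation.finset_sum_apply]

omit [IsScalarTower k A K] in
lemma anchor_y (i j : ι) : C.anchor i (algebraMap A K (C.y j)) = C.bivector i j := by
  classical
  simp [anchor_apply, C.der_y]

lemma anchor_algebraMap (i : ι) (a : A) :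
    C.anchor i (algebraMap A K a) = algebraMap A K (bracket (k := k) (C.y i) a) := by
  have : (C.anchor i).compAlgebraMap A =
      (Algebra.linearMap A K).compDer (hamiltonian k (C.y i)) :=
    C.ext_left fun j => C.anchor_y i j
  exact DFunLike.congr_fun this a

lemma algebraMap_bracket (a b : A) : algebraMap A K (bracket (k := k) a b) =
    ∑ i, C.der i (algebraMap A K a) * C.anchor i (algebraMap A K b) := by
  classical
  have : -(Algebra.linearMap A K).compDer (hamiltonian k b) =
      ∑ i, C.anchor i (algebraMap A K b) • (C.der i).compAlgebraMap A :=
    C.ext_left fun j => by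
      simp [hamiltonian_apply, C.der_y, anchor_algebraMap, Derivation.finset_sum_apply,
        bracket_swap b (C.y j)]
      exact Algebra.algebraMap_eq_smul_one _
  have := DFunLike.congr_fun this a
  simpa [hamiltonian_apply, bracket_swap b a, Derivation.finset_sum_apply, mul_comm]
    using this

/-- The derivative of the bracket. -/
lemma der_bracket (l : ι) (a b : A) :
    C.der l (algebraMap A K (bracket (k := k) a b)) =
      ∑ i, C.der i (algebraMap A K a) * C.anchor i (C.der l (algebraMap A K b)) -
      ∑ i, C.der i (algebraMap A K b) * C.anchor i (C.der l (algebraMap A K a)) +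
      ∑ i, ∑ j, C.der i (algebraMap A K a) * C.der j (algebraMap A K b) *
        C.der l (C.bivector i j) := by
  have h1 : ∑ i, C.der i (algebraMap A K b) * C.anchor i (C.der l (algebraMap A K a)) =
      -∑ i, C.der l (C.der i (algebraMap A K a)) * C.anchor i (algebraMap A K b) := by
    simp only [anchor_apply, Finset.mul_sum]
    rw [Finset.sum_comm, ← Finset.sum_neg_distrib]
    refine Finset.sum_congr rfl fun i _ => ?_
    rw [← Finset.sum_neg_distrib]
    refine Finset.sum_congr rfl fun j _ => ?_
    rw [C.bivector_swap j i, C.der_comm i l]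
    ring
  rw [h1, C.algebraMap_bracket, map_sum, sub_neg_eq_add, ← Finset.sum_add_distrib,
    ← Finset.sum_add_distrib]
  refine Finset.sum_congr rfl fun i _ => ?_
  simp only [Derivation.leibniz, anchor_apply, map_sum, smul_eq_mul, Finset.mul_sum,
    ← Finset.sum_add_distrib]
  refine Finset.sum_congr rfl fun j _ => ?_
  rw [C.der_comm j l]
  ring

/-- The frame of the Lie–Rinehart algebra of Kähler differentials with basis `d y i`. -/
noncomputable def frame : LieRinehartFrame k K ι where
  X := C.anchor
  c i j l := C.der l (C.bivector i j)
  c_self i l := by rw [bivector_self, map_zero]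
  c_swap i j l := by rw [bivector_swap, map_neg]
  X_comm i j f := by
    have : ⁅C.anchor i, C.anchor j⁆ = ∑ l, C.der l (C.bivector i j) • C.anchor l :=
      C.ext_right fun m => by
        have h1 := C.algebraMap_bracket (bracket (k := k) (C.y i) (C.y j)) (C.y m)
        have h2 := jacobi (k := k) (C.y i) (C.y j) (C.y m)
        rw [bracket_swap (C.y m) (bracket (k := k) (C.y i) (C.y j)),
          bracket_swap (C.y m) (C.y i), map_neg] at h2
        rw [Derivation.commutator_apply, C.anchor_algebraMap j, C.anchor_algebraMap i,
          C.anchor_algebraMap i, C.anchor_algebraMap j, Derivation.finset_sum_apply, ← map_sub]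
        refine Eq.trans (congrArg _ ?_) h1
        linear_combination h2
    have := DFunLike.congr_fun this f
    simpa [Derivation.commutator_apply, Derivation.finset_sum_apply] using this
  jacobi i j p m := by
    have key : ∀ i j p, C.anchor i (C.der m (C.bivector j p)) +
        ∑ l, C.der l (C.bivector j p) * C.der m (C.bivector i l) =
        C.der m (algebraMap A K (bracket (k := k) (C.y i) (bracket (k := k) (C.y j) (C.y p)))) := by
      intro i j p
      rw [← C.anchor_algebraMap, anchor_apply, anchor_apply, map_sum, ← Finset.sum_add_distrib]
      refine Finset.sum_congr rfl fun l _ => ?_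
      rw [Derivation.leibniz, C.der_comm m l]
      simp [bivector]
    rw [key, key, key, ← map_add, ← map_add, ← map_add, ← map_add, jacobi, map_zero, map_zero]

variable [LinearOrder ι]

/-- The action of `h_a` on polynomials in the basis elements. -/
noncomputable def repH : A →ₗ[k] Module.End k (Multiset ι →₀ K) :=
  ∑ i, (LinearMap.toSpanSingleton K (Module.End k (Multiset ι →₀ K))
    (C.frame.act i)).restrictScalars k ∘ₗ (C.der i).toLinearMap ∘ₗ
      (IsScalarTower.toAlgHom k A K).toLinearMap

lemma repH_apply (a : A) (m : Multiset ι →₀ K) :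
    C.repH a m = ∑ i, C.der i (algebraMap A K a) • C.frame.act i m := by
  simp [repH]

omit [PoissonAlgebra k A] [Fintype ι] [LinearOrder ι] in
variable (k A K ι) in
/-- The action of `m_a` on polynomials in the basis elements, by scalars. -/
noncomputable def scalarRep : A →ₗ[k] Module.End k (Multiset ι →₀ K) :=
  (LinearMap.toSpanSingleton K (Module.End k (Multiset ι →₀ K)) 1).restrictScalars k ∘ₗ
      (IsScalarTower.toAlgHom k A K).toLinearMap

omit [PoissonAlgebra k A] [Fintype ι] [LinearOrder ι] in
lemma scalarRep_apply (a : A) (m : Multiset ι →₀ K) :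
    scalarRep k A K ι a m = algebraMap A K a • m := by
  simp [scalarRep]

lemma repH_smul (a : A) (f : K) (m : Multiset ι →₀ K) : C.repH a (f • m) =
    (∑ i, C.der i (algebraMap A K a) * C.anchor i f) • m + f • C.repH a m := by
  simp only [repH_apply, LieRinehartFrame.act_smul, smul_add, Finset.sum_add_distrib, smul_smul,
    Finset.sum_smul, Finset.smul_sum, mul_comm f]
  rfl

lemma repH_bracket (a b : A) (m : Multiset ι →₀ K) :
    C.repH (bracket (k := k) a b) m = C.repH a (C.repH b m) - C.repH b (C.repH a m) := by
  have key : ∀ a b : A, C.repH a (C.repH b m) =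
      ∑ l, (∑ i, C.der i (algebraMap A K a) * C.anchor i (C.der l (algebraMap A K b))) •
        C.frame.act l m + ∑ i, ∑ j, (C.der i (algebraMap A K a) * C.der j (algebraMap A K b)) •
          C.frame.act i (C.frame.act j m) := by
    intro a b
    rw [C.repH_apply b, map_sum]
    simp only [repH_smul, Finset.sum_add_distrib]
    congr 1
    rw [Finset.sum_comm]
    refine Finset.sum_congr rfl fun j _ => ?_
    rw [repH_apply, Finset.smul_sum]
    refine Finset.sum_congr rfl fun i _ => ?_
    rw [smul_smul, mul_comm]
  have hsw : ∑ i, ∑ j, (C.der i (algebraMap A K b) * C.der j (algebraMap A K a)) •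
          C.frame.act i (C.frame.act j m) =
      ∑ i, ∑ j, (C.der i (algebraMap A K a) * C.der j (algebraMap A K b)) •
          C.frame.act j (C.frame.act i m) := by
    rw [Finset.sum_comm]
    simp only [mul_comm]
  have hc : ∑ i, ∑ j, (C.der i (algebraMap A K a) * C.der j (algebraMap A K b)) •
          C.frame.act i (C.frame.act j m) =
      ∑ i, ∑ j, (C.der i (algebraMap A K a) * C.der j (algebraMap A K b)) •
          C.frame.act j (C.frame.act i m) +
      ∑ l, (∑ i, ∑ j, C.der i (algebraMap A K a) * C.der j (algebraMap A K b) *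
        C.der l (C.bivector i j)) • C.frame.act l m := by
    have hcomm : ∀ i j, C.frame.act i (C.frame.act j m) = C.frame.act j (C.frame.act i m) +
        ∑ l, C.der l (C.bivector i j) • C.frame.act l m := fun i j => C.frame.act_comm i j m
    rw [Finset.sum_congr rfl fun i _ => Finset.sum_congr rfl fun j _ => by rw [hcomm i j]]
    simp only [smul_add, Finset.sum_add_distrib, Finset.sum_smul,
      Finset.smul_sum, smul_smul]
    congr 1
    symm
    rw [Finset.sum_comm]
    refine Finset.sum_congr rfl fun i _ => ?_
    rw [Finset.sum_comm]
  rw [key a b, key b a, hsw, hc, repH_apply]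
  simp only [der_bracket, add_smul, sub_smul, Finset.sum_add_distrib, Finset.sum_sub_distrib]
  abel

/-- The representation of the Poisson enveloping algebra on polynomials in the basis elements. -/
noncomputable def rep : Enveloping k A →ₐ[k] Module.End k (Multiset ι →₀ K) :=
  RingQuot.liftAlgHom k ⟨TensorAlgebra.lift k ((scalarRep k A K ι).coprod C.repH), by
    intro x y h
    induction h with
    | m_mul x y => refine LinearMap.ext fun m => ?_; simp [freeM, scalarRep_apply, mul_smul]
    | h_bracket x y => refine LinearMap.ext fun m => ?_; simp [freeH, repH_bracket]
    | h_mul x y =>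
      refine LinearMap.ext fun m => ?_
      simp [freeM, freeH, scalarRep_apply, repH_apply, add_smul, mul_smul, Finset.sum_add_distrib]
      exact add_comm _ _
    | m_bracket x y =>
      refine LinearMap.ext fun m => ?_
      simp [freeM, freeH, scalarRep_apply, repH_smul, -algebraMap_smul]
      rw [C.algebraMap_bracket]
    | m_one => refine LinearMap.ext fun m => ?_; simp [freeM, scalarRep_apply]⟩

lemma rep_mk (x : TensorAlgebra k (A × A)) : C.rep (Enveloping.mk k A x) =
    TensorAlgebra.lift k ((scalarRep k A K ι).coprod C.repH) x :=
  RingQuot.liftAlgHom_mkAlgHom_apply _ _ _ x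

lemma rep_m (a : A) (x : Multiset ι →₀ K) :
    C.rep (Enveloping.m k A a) x = algebraMap A K a • x := by
  rw [Enveloping.m_def, rep_mk, freeM, TensorAlgebra.lift_ι_apply]
  simp [scalarRep_apply]

lemma rep_h (a : A) : C.rep (Enveloping.h k A a) = C.repH a := by
  rw [Enveloping.h_def, rep_mk, freeH, TensorAlgebra.lift_ι_apply]
  simp

lemma rep_h_y (i : ι) : C.rep (Enveloping.h k A (C.y i)) = C.frame.act i := by
  refine LinearMap.ext fun x => ?_
  simp [rep_h, repH_apply, C.der_y]

/-- If the coordinates are algebraically independent in `K`, then the products of a monomial in the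
`m_{y i}` and an ordered monomial in the `h_{y i}` are linearly independent: applied to the empty
monomial of the representation, they give the monomials `y ^ β • s`. -/
lemma linearIndependent_enveloping
    (hy : AlgebraicIndependent k fun i => algebraMap A K (C.y i)) :
    LinearIndependent k fun p : (ι →₀ ℕ) × Multiset ι =>
      Enveloping.m k A (MvPolynomial.aeval C.y (MvPolynomial.monomial p.1 (1 : k))) *
        ((p.2.sort (· ≤ ·)).map fun i => Enveloping.h k A (C.y i)).prod := by
  let ev : Enveloping k A →ₗ[k] (Multiset ι →₀ K) :=
    LinearMap.applyₗ (Finsupp.single 0 1) ∘ₗ C.rep.toLinearMap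
  refine LinearIndependent.of_comp ev ?_
  have hmon : LinearIndependent k fun β : ι →₀ ℕ =>
      algebraMap A K (MvPolynomial.aeval C.y (MvPolynomial.monomial β (1 : k))) := by
    have h1 := (MvPolynomial.basisMonomials ι k).linearIndependent
    have h2 : Function.Injective (MvPolynomial.aeval (R := k) fun i => algebraMap A K (C.y i)) := hy
    have h3 := h1.map' (MvPolynomial.aeval (R := k) fun i => algebraMap A K (C.y i)).toLinearMap
      (LinearMap.ker_eq_bot.2 h2)
    have h4 : (fun β : ι →₀ ℕ => algebraMap A K (MvPolynomial.aeval C.y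
        (MvPolynomial.monomial β (1 : k)))) =
        (MvPolynomial.aeval (R := k) fun i => algebraMap A K (C.y i)).toLinearMap ∘
          (MvPolynomial.basisMonomials ι k) := by
      funext β
      simp [MvPolynomial.aeval_monomial, Finsupp.prod]
    rw [h4]
    exact h3
  have hsing := Finsupp.linearIndependent_single (R := k) (ι := Multiset ι) (M := K)
    (φ := fun _ => ι →₀ ℕ) (f := fun _ β =>
      algebraMap A K (MvPolynomial.aeval C.y (MvPolynomial.monomial β (1 : k)))) (fun _ => hmon)
  have hinj : Function.Injective fun p : (ι →₀ ℕ) × Multiset ι =>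
      (⟨p.2, p.1⟩ : (_ : Multiset ι) × (ι →₀ ℕ)) := by
    rintro ⟨a, b⟩ ⟨c, d⟩ h
    simp only [Sigma.mk.injEq, heq_eq_eq] at h
    rw [h.1, h.2]
  have h5 := hsing.comp _ hinj
  convert h5 using 1
  funext ⟨β, s⟩
  have h6 := C.frame.prod_map_act_single_zero (s.sort (· ≤ ·)) (s.pairwise_sort (· ≤ ·))
  simp only [Function.comp_apply, ev, LinearMap.comp_apply, LinearMap.applyₗ_apply_apply,
    AlgHom.toLinearMap_apply, map_mul, Module.End.mul_apply, map_list_prod, List.map_map]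
  simp only [Function.comp_def, rep_h_y, h6, rep_m, Multiset.sort_eq, Finsupp.smul_single,
    smul_eq_mul, mul_one]

end Coordinates

end PoissonAlgebra

/-! ### Krull dimension and coordinates -/

section Dimension

/-- Integral extensions preserve the Krull dimension. -/
lemma ringKrullDim_eq_of_isIntegral (R S : Type*) [CommRing R] [CommRing S] [Algebra R S]
    [Algebra.IsIntegral R S] [FaithfulSMul R S] : ringKrullDim S = ringKrullDim R := by
  refine le_antisymm (Order.krullDim_le_of_strictMono (PrimeSpectrum.comap (algebraMap R S))
    fun I J h => Ideal.IsIntegral.comap_lt_comap h) (iSup_le fun l => ?_)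
  obtain ⟨P, hP, hl⟩ := Ideal.exists_ideal_over_prime_of_isIntegral l.head.asIdeal (⊥ : Ideal S)
    (by
      rw [← RingHom.ker_eq_comap_bot, (RingHom.injective_iff_ker_eq_bot _).1
        (FaithfulSMul.algebraMap_injective R S)]
      exact bot_le)
  have : P.IsPrime := hl.1
  have : P.LiesOver l.head.asIdeal := ⟨hl.2.symm⟩
  obtain ⟨L, hL, -⟩ := Ideal.exists_ltSeries_of_hasGoingUp l P
  rw [← hL]
  exact le_iSup (fun l : LTSeries (PrimeSpectrum S) => (l.length : WithBot ℕ∞)) L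

/-- Noether normalization, with the number of variables identified as the Krull dimension. -/
lemma exists_finite_inj_algHom_ringKrullDim_eq (k A : Type*) [Field k] [CommRing A] [Nontrivial A]
    [Algebra k A] [Algebra.FiniteType k A] : ∃ d : ℕ, ∃ g : MvPolynomial (Fin d) k →ₐ[k] A,
      Function.Injective g ∧ g.Finite ∧ ringKrullDim A = d := by
  obtain ⟨d, g, hg, hf⟩ := exists_finite_inj_algHom_of_fg k A
  refine ⟨d, g, hg, hf, ?_⟩
  let := g.toRingHom.toAlgebra
  have : Module.Finite (MvPolynomial (Fin d) k) A := hf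
  have : FaithfulSMul (MvPolynomial (Fin d) k) A :=
    (faithfulSMul_iff_algebraMap_injective _ _).2 hg
  rw [ringKrullDim_eq_of_isIntegral (MvPolynomial (Fin d) k) A]
  simp

end Dimension

section Etale

variable {R S T M : Type*} [CommRing R] [CommRing S] [CommRing T]
  [Algebra R S] [Algebra R T] [Algebra S T] [IsScalarTower R S T] [Algebra.FormallyEtale S T]
  [AddCommGroup M] [Module R M] [Module S M] [Module T M] [IsScalarTower R T M]
  [IsScalarTower S T M]

omit [IsScalarTower R S T] [Algebra R S] [Module S M] [IsScalarTower S T M]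
  [IsScalarTower R T M] in
lemma Derivation.eq_zero_of_formallyUnramified (D : Derivation R T M)
    (h : ∀ s : S, D (algebraMap S T s) = 0) : D = 0 := by
  let := Module.compHom M (algebraMap S T)
  have : IsScalarTower S T M := ⟨fun s t m => by
    rw [Algebra.smul_def, mul_smul]; rfl⟩
  let D' : Derivation S T M := Derivation.mk'
    { toFun := D, map_add' := D.map_add, map_smul' := fun s t => by
        rw [Algebra.smul_def, D.leibniz, h, smul_zero, add_zero, algebraMap_smul,
          RingHom.id_apply] }
    D.leibniz
  have h0 : D'.liftKaehlerDifferential = 0 := LinearMap.ext fun x => by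
    rw [Subsingleton.elim x 0, map_zero, map_zero]
  ext t
  change D' t = 0
  rw [← D'.liftKaehlerDifferential_comp_D, h0, LinearMap.zero_apply]

lemma Derivation.exists_extension_of_formallyEtale (D : Derivation R S M) :
    ∃ D' : Derivation R T M, ∀ s, D' (algebraMap S T s) = D s := by
  let e := KaehlerDifferential.tensorKaehlerEquivOfFormallyEtale R S T
  have : SMulCommClass S T M := IsScalarTower.to_smulCommClass
  have : IsScalarTower R S M := IsScalarTower.to₁₂₄ R S T M
  let f : TensorProduct S T Ω[S⁄R] →ₗ[T] M :=
    TensorProduct.AlgebraTensorModule.lift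
      ((LinearMap.lsmul T (Ω[S⁄R] →ₗ[S] M)).flip D.liftKaehlerDifferential)
  refine ⟨(f ∘ₗ e.symm.toLinearMap).compDer (KaehlerDifferential.D R T), fun s => ?_⟩
  simp [e, f, KaehlerDifferential.tensorKaehlerEquivOfFormallyEtale_symm_D_algebraMap]

end Etale

namespace PoissonAlgebra

/-- If `K` is a localization of `A` that is algebraic over polynomials `k[X i]` mapping to `A`, then
the images of the `X i` are coordinates. -/
lemma exists_coordinates_of_isLocalization {k A K ι : Type*} [Field k] [CharZero k]
    [CommRing A] [Algebra k A] [Field K] [Algebra k K] [Algebra A K] [IsScalarTower k A K]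
    [Algebra (MvPolynomial ι k) A] [Algebra (MvPolynomial ι k) K]
    [IsScalarTower (MvPolynomial ι k) A K] [IsScalarTower k (MvPolynomial ι k) K]
    [FaithfulSMul (MvPolynomial ι k) K] [Algebra.IsAlgebraic (MvPolynomial ι k) K]
    (S : Submonoid A) [IsLocalization S K] :
    ∃ C : Coordinates k A K ι, ∀ i, C.y i = algebraMap (MvPolynomial ι k) A (MvPolynomial.X i) := by
  classical
  let P := MvPolynomial ι k
  let y (i : ι) : A := algebraMap P A (.X i)
  have hX (i) : algebraMap P K (MvPolynomial.X i) = algebraMap A K (y i) :=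
    IsScalarTower.algebraMap_apply _ _ _ _
  have : CharZero K := charZero_of_injective_algebraMap (algebraMap k K).injective
  let F := FractionRing P
  let : Algebra F K := FractionRing.liftAlgebra P K
  have : Algebra.IsAlgebraic F K := ⟨fun x =>
    (Algebra.IsAlgebraic.isAlgebraic (R := P) x).extendScalars (IsFractionRing.injective P F)⟩
  have : CharZero F := charZero_of_injective_algebraMap (algebraMap k F).injective
  have : Algebra.FormallyEtale P F := .of_isLocalization (nonZeroDivisors P)
  have : Algebra.FormallyEtale F K := .of_isSeparable F K
  have : Algebra.FormallyEtale P K := .comp P F K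
  have : Algebra.FormallyEtale A K := .of_isLocalization S
  have ext (D : Derivation k K K) (h : ∀ i, D (algebraMap A K (y i)) = 0) : D = 0 := by
    refine D.eq_zero_of_formallyUnramified (S := P) fun p => ?_
    have : D.compAlgebraMap P = 0 := MvPolynomial.derivation_ext fun i => by
      change D (algebraMap P K _) = _
      rw [hX, h, Derivation.zero_apply]
    exact DFunLike.congr_fun this p
  have hder (i : ι) : ∃ D : Derivation k K K, ∀ j,
      D (algebraMap A K (y j)) = if i = j then 1 else 0 := by
    obtain ⟨D, hD⟩ := Derivation.exists_extension_of_formallyEtale (T := K)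
      (MvPolynomial.mkDerivation k fun j => if i = j then (1 : K) else 0)
    exact ⟨D, fun j => by rw [← hX, hD, MvPolynomial.mkDerivation_X]⟩
  choose der hder using hder
  refine ⟨⟨fun i => y i, der, fun i => by simp [hder], fun h => by simp [hder, h], fun D h => ?_,
    fun D h => D.eq_zero_of_formallyUnramified h⟩, fun i => rfl⟩
  obtain ⟨D', hD'⟩ := Derivation.exists_extension_of_formallyEtale (T := K) D
  have h0 : D' = 0 := ext D' fun i => by rw [hD', h]
  ext a
  rw [← hD', h0, Derivation.zero_apply, Derivation.zero_apply]

/-- A regular algebra that is finite over the polynomial ring in the `y i` has these as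
coordinates over the field of fractions of some component. -/
lemma exists_coordinates {k : Type u} {A : Type v} {ι : Type*} [Field k] [CharZero k]
    [CommRing A] [Algebra k A] [IsRegularRing A] {g : MvPolynomial ι k →ₐ[k] A}
    (hg : Function.Injective g) (hf : g.IsIntegral) :
    ∃ (K : Type v) (_ : Field K) (_ : Algebra k K) (_ : Algebra A K) (_ : IsScalarTower k A K)
      (C : Coordinates k A K ι), (∀ i, C.y i = g (.X i)) ∧
        AlgebraicIndependent k fun i => algebraMap A K (C.y i) := by
  let : Algebra (MvPolynomial ι k) A := g.toRingHom.toAlgebra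
  have : Algebra.IsIntegral (MvPolynomial ι k) A := ⟨hf⟩
  obtain ⟨q, -, hq, hqg⟩ := Ideal.exists_ideal_over_prime_of_isIntegral
    (⊥ : Ideal (MvPolynomial ι k)) (⊥ : Ideal A)
    (by rw [← RingHom.ker_eq_comap_bot]; exact ((RingHom.injective_iff_ker_eq_bot _).1 hg).le)
  obtain ⟨p, hp, hpq⟩ := Ideal.exists_minimalPrimes_le (bot_le : ⊥ ≤ q)
  have : p.IsPrime := hp.1.1
  have hpg (x) (hx : g x ∈ p) : x = 0 := by
    have : x ∈ q.comap (algebraMap (MvPolynomial ι k) A) := hpq hx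
    simpa [hqg] using this
  have hdim : ringKrullDim (Localization.AtPrime p) = 0 := by
    rw [IsLocalization.AtPrime.ringKrullDim_eq_height p,
      Ideal.height_eq_zero_iff.2 hp]
    rfl
  have hfield : IsField (Localization.AtPrime p) :=
    IsRegularLocalRing.isField_of_ringKrullDim_eq_zero hdim
  -- The localization at `p` is a field, so it agrees with the residue field.
  have : IsLocalization.AtPrime p.ResidueField p := by
    have hb : Function.Bijective
        (IsScalarTower.toAlgHom A (Localization.AtPrime p) p.ResidueField) :=
      ⟨(RingHom.injective_iff_ker_eq_bot (IsLocalRing.residue _)).2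
        (by rw [IsLocalRing.ker_residue, IsLocalRing.isField_iff_maximalIdeal_eq.1 hfield]),
        IsLocalRing.residue_surjective⟩
    exact IsLocalization.isLocalization_of_algEquiv p.primeCompl (AlgEquiv.ofBijective _ hb)
  have hinj : Function.Injective (algebraMap (MvPolynomial ι k) p.ResidueField) := by
    rw [injective_iff_map_eq_zero]
    intro x hx
    rw [IsScalarTower.algebraMap_apply _ A, Ideal.algebraMap_residueField_eq_zero] at hx
    exact hpg x hx
  have : FaithfulSMul (MvPolynomial ι k) p.ResidueField :=
    (faithfulSMul_iff_algebraMap_injective _ _).2 hinj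
  have : IsScalarTower k (MvPolynomial ι k) p.ResidueField := .of_algebraMap_eq fun x => by
    rw [IsScalarTower.algebraMap_apply (MvPolynomial ι k) A, IsScalarTower.algebraMap_apply k A]
    exact congrArg _ (g.commutes x).symm
  have halg (a : A) : IsAlgebraic (MvPolynomial ι k) (algebraMap A p.ResidueField a) :=
    ((Algebra.IsIntegral.isIntegral a).map
      (IsScalarTower.toAlgHom (MvPolynomial ι k) A p.ResidueField)).isAlgebraic
  have : Algebra.IsAlgebraic (MvPolynomial ι k) p.ResidueField := ⟨fun x => by
    obtain ⟨a, s, rfl⟩ := IsLocalization.exists_mk'_eq p.primeCompl x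
    have h0 : algebraMap A p.ResidueField s ≠ 0 :=
      (IsLocalization.map_units p.ResidueField s).ne_zero
    rw [show IsLocalization.mk' p.ResidueField a s =
      algebraMap A p.ResidueField a * (algebraMap A p.ResidueField s)⁻¹ by
        rw [eq_mul_inv_iff_mul_eq₀ h0, IsLocalization.mk'_spec]]
    exact (halg a).mul (halg s).inv⟩
  obtain ⟨C, hC⟩ := exists_coordinates_of_isLocalization (k := k) (ι := ι) p.primeCompl
    (K := p.ResidueField)
  refine ⟨p.ResidueField, inferInstance, inferInstance, inferInstance, inferInstance, C, hC, ?_⟩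
  have : (MvPolynomial.aeval fun i => algebraMap A p.ResidueField (C.y i)) =
      IsScalarTower.toAlgHom k (MvPolynomial ι k) p.ResidueField := by
    refine MvPolynomial.algHom_ext fun i => ?_
    rw [MvPolynomial.aeval_X, hC]
    exact (IsScalarTower.algebraMap_apply _ _ _ _).symm
  rw [AlgebraicIndependent, this]
  exact hinj

end PoissonAlgebra

/-! ### Growth of algebras, and the lower bound -/

section Growth

open Filter Topology

variable {k : Type u} {R : Type v} [Field k] [Ring R] [Algebra k R]

lemma FiniteDimensional.biSup_range_pow (V : Submodule k R) [FiniteDimensional k V] (n : ℕ) :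
    FiniteDimensional k ↥(⨆ i ∈ Finset.range n, V ^ i) := by
  have : V.FG := Module.Finite.iff_fg.1 inferInstance
  exact Module.Finite.iff_fg.2 (Submodule.fg_biSup _ _ fun i _ => this.pow i)

/-- The factor `q` does not matter in the limit: `log (q * n)` is asymptotic to `log n`. -/
lemma le_gelfandKirillovDim_of_pow_le (V : Submodule k R) [FiniteDimensional k V] {e q : ℕ}
    (hq : q ≠ 0) (h : ∀ n, n ^ e ≤ Module.finrank k ↥(⨆ i ∈ Finset.range (q * n + 1), V ^ i)) :
    ((e : ℕ) : EReal) ≤ gelfandKirillovDim k R := by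
  refine le_trans ?_ (le_iSup₂
    (f := fun (V : Submodule k R) (_ : FiniteDimensional k V) => limsup (fun n : ℕ =>
      ((Real.logb n (Module.finrank k ↥(⨆ i ∈ Finset.range (n + 1), V ^ i)) : ℝ) : EReal)) atTop)
    V inferInstance)
  have hq' : Tendsto (fun n => q * n) atTop atTop :=
    tendsto_id.const_mul_atTop' (Nat.pos_of_ne_zero hq)
  refine le_trans ?_ (limsup_le_limsup_of_le (f := map (fun n => q * n) atTop) hq')
  rw [← limsup_comp]
  have hlim : Tendsto (fun n : ℕ => ((e * (Real.log n / (Real.log q + Real.log n)) : ℝ) : EReal))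
      atTop (𝓝 ((e : ℕ) : EReal)) := by
    have h1 : Tendsto (fun n : ℕ => Real.log n) atTop atTop :=
      Real.tendsto_log_atTop.comp tendsto_natCast_atTop_atTop
    have h2 : Tendsto (fun n : ℕ => Real.log q / (Real.log q + Real.log n)) atTop (𝓝 0) :=
      tendsto_const_nhds.div_atTop (tendsto_atTop_add_const_left _ _ h1)
    have h3 : Tendsto (fun n : ℕ => (e : ℝ) * (1 - Real.log q / (Real.log q + Real.log n))) atTop
        (𝓝 ((e : ℝ) * (1 - 0))) := (tendsto_const_nhds.sub h2).const_mul _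
    rw [sub_zero, mul_one] at h3
    have h4 := (EReal.continuous_coe_iff.2 continuous_id).tendsto (e : ℝ) |>.comp h3
    refine Tendsto.congr' ?_ h4
    filter_upwards [h1.eventually_gt_atTop 0, eventually_ge_atTop 1] with n hn hn1
    have : 0 ≤ Real.log q := Real.log_natCast_nonneg q
    have : Real.log q + Real.log n ≠ 0 := by positivity
    simp only [Function.comp_apply, id]
    congr 2
    field_simp
    ring
  rw [← hlim.limsup_eq]
  refine limsup_le_limsup ?_
  filter_upwards [eventually_ge_atTop 2] with n hn
  have hn' : (n : ℝ) ≠ 0 := by positivity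
  simp only [Function.comp_apply, EReal.coe_le_coe_iff]
  have h1 : (1 : ℝ) < ((q * n : ℕ) : ℝ) := by
    exact_mod_cast lt_of_lt_of_le hn (Nat.le_mul_of_pos_left n (Nat.pos_of_ne_zero hq))
  calc (e * (Real.log n / (Real.log q + Real.log n)) : ℝ)
      = Real.logb ((q * n : ℕ) : ℝ) ((n : ℝ) ^ e) := by
        rw [Real.logb, Real.log_pow, Nat.cast_mul, Real.log_mul (by exact_mod_cast hq) hn',
          mul_div_assoc]
    _ ≤ _ := Real.logb_le_logb_of_le h1 (by positivity) (by exact_mod_cast h n)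

lemma gelfandKirillovDim_le_of_le_pow {e : ℕ}
    (h : ∀ V : Submodule k R, FiniteDimensional k V → ∃ C : ℕ, ∀ n, 1 ≤ n →
      Module.finrank k ↥(⨆ i ∈ Finset.range (n + 1), V ^ i) ≤ C * n ^ e) :
    gelfandKirillovDim k R ≤ ((e : ℕ) : EReal) := by
  refine iSup₂_le fun V hV => ?_
  obtain ⟨C, hC⟩ := h V hV
  have hlim : Tendsto (fun n : ℕ => ((Real.log (C + 1 : ℕ) / Real.log n + e : ℝ) : EReal))
      atTop (𝓝 ((e : ℕ) : EReal)) := by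
    have h1 : Tendsto (fun n : ℕ => Real.log n) atTop atTop :=
      Real.tendsto_log_atTop.comp tendsto_natCast_atTop_atTop
    have h3 : Tendsto (fun n : ℕ => Real.log (C + 1 : ℕ) / Real.log n + (e : ℝ)) atTop
        (𝓝 (0 + (e : ℝ))) := (tendsto_const_nhds.div_atTop h1).add_const _
    rw [zero_add] at h3
    exact (EReal.continuous_coe_iff.2 continuous_id).tendsto (e : ℝ) |>.comp h3
  rw [← hlim.limsup_eq]
  refine limsup_le_limsup ?_
  filter_upwards [eventually_ge_atTop 2] with n hn
  have hn1 : (1 : ℝ) < n := by exact_mod_cast hn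
  have hlog : 0 < Real.log n := Real.log_pos hn1
  have hn' : (n : ℝ) ≠ 0 := by positivity
  simp only [EReal.coe_le_coe_iff]
  have hC1 : ((C + 1 : ℕ) : ℝ) ≠ 0 := by positivity
  have heq : Real.log (C + 1 : ℕ) / Real.log n + e =
      Real.logb n (((C + 1 : ℕ) : ℝ) * (n : ℝ) ^ e) := by
    rw [Real.logb, Real.log_mul hC1 (by positivity), Real.log_pow]
    field_simp
  rw [heq]
  rcases Nat.eq_zero_or_pos (Module.finrank k ↥(⨆ i ∈ Finset.range (n + 1), V ^ i)) with h0 | h0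
  · rw [h0, Nat.cast_zero, Real.logb_zero, ← heq]
    have := Real.log_natCast_nonneg (C + 1)
    positivity
  · refine Real.logb_le_logb_of_le hn1 (by exact_mod_cast h0) ?_
    exact_mod_cast (hC n (by omega)).trans (Nat.mul_le_mul_right _ (Nat.le_succ C))

end Growth

namespace PoissonAlgebra

lemma list_prod_mem_pow {k R : Type*} [CommSemiring k] [Semiring R] [Algebra k R]
    {V : Submodule k R} {l : List R} (h : ∀ x ∈ l, x ∈ V) : l.prod ∈ V ^ l.length := by
  induction l with
  | nil => simp [Submodule.one_le.1 (le_refl (1 : Submodule k R))]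
  | cons a l ih =>
    rw [List.prod_cons, List.length_cons, pow_succ']
    exact Submodule.mul_mem_mul (h a (by simp)) (ih fun x hx => h x (by simp [hx]))

variable {k : Type u} {A : Type v} {K : Type*} [Field k] [CommRing A] [Algebra k A]
  [PoissonAlgebra k A] [Field K] [Algebra k K] [Algebra A K] [IsScalarTower k A K]

lemma Coordinates.le_gelfandKirillovDim {d : ℕ} (C : Coordinates k A K (Fin d))
    (hy : AlgebraicIndependent k fun i => algebraMap A K (C.y i)) :
    ((2 * d : ℕ) : EReal) ≤ gelfandKirillovDim k (Enveloping k A) := by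
  let g : Option (Fin d ⊕ Fin d) → Enveloping k A :=
    fun o => o.elim 1 (Sum.elim (fun i => Enveloping.m k A (C.y i))
      fun i => Enveloping.h k A (C.y i))
  let V : Submodule k (Enveloping k A) := Submodule.span k (Set.range g)
  have : FiniteDimensional k V := FiniteDimensional.span_of_finite k (Set.finite_range g)
  have hV1 : (1 : Submodule k (Enveloping k A)) ≤ V :=
    Submodule.one_le.2 (Submodule.subset_span ⟨none, rfl⟩)
  have hVm (i) : Enveloping.m k A (C.y i) ∈ V := Submodule.subset_span ⟨some (.inl i), rfl⟩
  have hVh (i) : Enveloping.h k A (C.y i) ∈ V := Submodule.subset_span ⟨some (.inr i), rfl⟩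
  -- One more than `2 * d`, since the factor must not vanish for `d = 0`.
  refine le_gelfandKirillovDim_of_pow_le V (q := 2 * d + 1) (by omega) fun n => ?_
  have := FiniteDimensional.biSup_range_pow V ((2 * d + 1) * n + 1)
  have hli := C.linearIndependent_enveloping hy
  -- The `n ^ (2 * d)` monomials with exponents below `n` have length at most `2 * d * n`.
  let φ : (Fin d → Fin n) × (Fin d → Fin n) → (Fin d →₀ ℕ) × Multiset (Fin d) := fun p =>
    (Finsupp.equivFunOnFinite.symm fun i => (p.1 i : ℕ),
      Finsupp.toMultiset (Finsupp.equivFunOnFinite.symm fun i => (p.2 i : ℕ)))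
  have hφ : Function.Injective φ := by
    rintro ⟨a, b⟩ ⟨a', b'⟩ h
    simp only [φ, Prod.mk.injEq, EmbeddingLike.apply_eq_iff_eq] at h
    refine Prod.ext (funext fun i => Fin.ext ?_) (funext fun i => Fin.ext ?_)
    · exact congrFun h.1 i
    · exact DFunLike.congr_fun (Multiset.toFinsupp.symm.injective h.2) i
  have hmem (p : (Fin d → Fin n) × (Fin d → Fin n)) :
      Enveloping.m k A (MvPolynomial.aeval C.y (MvPolynomial.monomial (φ p).1 (1 : k))) *
        (((φ p).2.sort (· ≤ ·)).map fun i => Enveloping.h k A (C.y i)).prod ∈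
        ⨆ i ∈ Finset.range ((2 * d + 1) * n + 1), V ^ i := by
    have hcard (w : Fin d → Fin n) : (Finsupp.toMultiset
        (Finsupp.equivFunOnFinite.symm fun i => (w i : ℕ))).card ≤ d * n := by
      rw [Finsupp.card_toMultiset, Finsupp.sum_fintype _ _ fun _ => rfl]
      refine (Finset.sum_le_card_nsmul _ _ n fun i _ => ?_).trans (by simp)
      exact (w i).2.le
    have h1 : Enveloping.m k A (MvPolynomial.aeval C.y (MvPolynomial.monomial (φ p).1 (1 : k))) ∈
        V ^ (d * n) := by
      have : Enveloping.m k A (MvPolynomial.aeval C.y (MvPolynomial.monomial (φ p).1 (1 : k))) =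
          (((Finsupp.toMultiset (φ p).1).toList).map fun i => Enveloping.m k A (C.y i)).prod := by
        rw [← Function.comp_def (Enveloping.m k A), ← List.map_map, ← map_list_prod,
          MvPolynomial.aeval_monomial, map_one, one_mul, ← Multiset.prod_coe, ← Multiset.map_coe,
          Multiset.coe_toList, Finsupp.toMultiset_map,
          Finsupp.prod_toMultiset, Finsupp.prod_mapDomain_index] <;> simp [pow_add]
      rw [this]
      refine pow_le_pow_right' hV1 (hcard p.1) ?_
      convert list_prod_mem_pow (V := V) ?_
      · simp [φ]
      · simp only [List.mem_map]
        rintro _ ⟨i, -, rfl⟩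
        exact hVm i
    have h2 : (((φ p).2.sort (· ≤ ·)).map fun i => Enveloping.h k A (C.y i)).prod ∈
        V ^ (d * n) := by
      refine pow_le_pow_right' hV1 (hcard p.2) ?_
      convert list_prod_mem_pow (V := V) ?_
      · simp [φ]
      · simp only [List.mem_map]
        rintro _ ⟨i, -, rfl⟩
        exact hVh i
    have h3 := Submodule.mul_mem_mul h1 h2
    rw [← pow_add] at h3
    exact (le_biSup (fun i => V ^ i) (Finset.mem_range.2 (by nlinarith))) h3
  let f : (Fin d → Fin n) × (Fin d → Fin n) →
    ↥(⨆ i ∈ Finset.range ((2 * d + 1) * n + 1), V ^ i) := fun p => ⟨_, hmem p⟩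
  have hf : LinearIndependent k f :=
    LinearIndependent.of_comp (Submodule.subtype _) (hli.comp φ hφ)
  have := hf.fintype_card_le_finrank
  rwa [Fintype.card_prod, Fintype.card_fun, Fintype.card_fin, Fintype.card_fin, ← pow_add,
    ← two_mul] at this

end PoissonAlgebra

/-! ### Growth of affine commutative algebras -/

section CommGrowth

open Pointwise

lemma Submodule.FG.exists_le_of_monotone {k M I : Type*} [Semiring k] [AddCommMonoid M] [Module k M]
    [SemilatticeSup I] [Nonempty I] {F : I → Submodule k M} (hF : Monotone F)
    (h : ∀ x, ∃ i, x ∈ F i) {V : Submodule k M} (hV : V.FG) : ∃ i, V ≤ F i := by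
  classical
  obtain ⟨T, rfl⟩ := hV
  choose i hi using h
  obtain ⟨j, hj⟩ := (T.image i).exists_le
  exact ⟨j, Submodule.span_le.2 fun x hx => hF (hj _ (Finset.mem_image_of_mem i hx)) (hi x)⟩

lemma Submodule.finrank_iSup_le_of_fintype {k M I : Type*} [Field k] [AddCommGroup M] [Module k M]
    [Fintype I] (F : I → Submodule k M) [∀ i, FiniteDimensional k (F i)] {r : ℕ}
    (h : ∀ i, Module.finrank k (F i) ≤ r) :
    Module.finrank k ↥(⨆ i, F i) ≤ Fintype.card I * r := by
  classical
  have : ∀ T : Finset I, Module.finrank k ↥(⨆ i ∈ T, F i) ≤ T.card * r := by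
    intro T
    induction T using Finset.induction_on with
    | empty => simp
    | insert a T ha ih =>
      rw [Finset.iSup_insert, Finset.card_insert_of_notMem ha, add_mul, one_mul, add_comm]
      have : FiniteDimensional k ↥(⨆ i ∈ T, F i) :=
        Finset.sup_eq_iSup T F ▸ Submodule.finite_finset_sup T F
      exact (Submodule.finrank_add_le_finrank_add_finrank _ _).trans (add_le_add (h a) ih)
  have h1 := this Finset.univ
  rwa [← Finset.sup_eq_iSup, Finset.sup_univ_eq_iSup] at h1

variable {k A : Type*} [Field k] [CommRing A] [Algebra k A]

/-- The span of the monomials in `y` in which all exponents are at most `n`. -/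
def monomialSpan {d : ℕ} (k : Type*) [Field k] [Algebra k A] (y : Fin d → A) (n : ℕ) :
    Submodule k A :=
  Submodule.span k (Set.range fun u : Fin d → Fin (n + 1) => ∏ i, y i ^ (u i : ℕ))

variable {d : ℕ} (y : Fin d → A)

lemma prod_pow_mem_monomialSpan {n : ℕ} {u : Fin d → ℕ} (h : ∀ i, u i ≤ n) :
    ∏ i, y i ^ u i ∈ monomialSpan k y n :=
  Submodule.subset_span ⟨fun i => ⟨u i, Nat.lt_succ_of_le (h i)⟩, rfl⟩

lemma one_mem_monomialSpan (n : ℕ) : 1 ∈ monomialSpan k y n := by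
  simpa using prod_pow_mem_monomialSpan (k := k) y (u := 0) (n := n) (by simp)

lemma monomialSpan_mono : Monotone (monomialSpan k y) := fun _ _ h =>
  Submodule.span_le.2 <| by
    rintro _ ⟨u, rfl⟩
    exact prod_pow_mem_monomialSpan y fun i => (Nat.le_of_lt_succ (u i).2).trans h

lemma monomialSpan_mul_le (a b : ℕ) :
    monomialSpan k y a * monomialSpan k y b ≤ monomialSpan k y (a + b) := by
  rw [monomialSpan, monomialSpan, Submodule.span_mul_span, Submodule.span_le]
  rintro _ ⟨_, ⟨u, rfl⟩, _, ⟨w, rfl⟩, rfl⟩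
  simp only [← Finset.prod_mul_distrib, ← pow_add]
  exact prod_pow_mem_monomialSpan y fun i =>
    add_le_add (Nat.le_of_lt_succ (u i).2) (Nat.le_of_lt_succ (w i).2)

lemma exists_aeval_mem_monomialSpan (p : MvPolynomial (Fin d) k) :
    ∃ n, MvPolynomial.aeval y p ∈ monomialSpan k y n := by
  refine ⟨p.totalDegree, ?_⟩
  rw [MvPolynomial.aeval_eq_eval₂Hom, MvPolynomial.coe_eval₂Hom, MvPolynomial.eval₂_eq']
  refine Submodule.sum_mem _ fun u hu => ?_
  rw [← Algebra.smul_def]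
  refine Submodule.smul_mem _ _ (prod_pow_mem_monomialSpan y fun i => ?_)
  exact (Finsupp.le_degree i u).trans (MvPolynomial.le_totalDegree hu)

/-- In an algebra that is finite over polynomials in `d` variables, the powers of a
finite-dimensional subspace grow at most like a polynomial of degree `d`. -/
lemma exists_finrank_pow_le {g : MvPolynomial (Fin d) k →ₐ[k] A} (hg : g.Finite)
    (W : Submodule k A) [FiniteDimensional k W] :
    ∃ C : ℕ, ∀ n, Module.finrank k ↥(W ^ n) ≤ C * (n + 1) ^ d := by
  let : Algebra (MvPolynomial (Fin d) k) A := g.toRingHom.toAlgebra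
  have : Module.Finite (MvPolynomial (Fin d) k) A := hg
  obtain ⟨T, hT⟩ := this.fg_top
  let y (i : Fin d) : A := g (.X i)
  have hy (p) : g p = MvPolynomial.aeval y p := DFunLike.congr_fun (MvPolynomial.aeval_unique g) p
  classical
  let E : Submodule k A := Submodule.span k (insert 1 T : Finset A)
  have hE1 : (1 : Submodule k A) ≤ E := Submodule.one_le.2 (Submodule.subset_span (by simp))
  have hcov (x : A) : ∃ n, x ∈ monomialSpan k y n * E := by
    have hx : x ∈ Submodule.span (MvPolynomial (Fin d) k) (T : Set A) := hT ▸ Submodule.mem_top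
    induction hx using Submodule.span_induction with
    | mem x hx =>
      refine ⟨0, ?_⟩
      rw [← one_mul x]
      exact Submodule.mul_mem_mul (one_mem_monomialSpan y 0)
        (Submodule.subset_span (by simp [Finset.mem_coe.1 hx]))
    | zero => exact ⟨0, zero_mem _⟩
    | add a b _ _ iha ihb =>
      obtain ⟨n, hn⟩ := iha
      obtain ⟨m, hm⟩ := ihb
      exact ⟨max n m, add_mem
        (mul_le_mul' (monomialSpan_mono y (le_max_left _ _)) le_rfl hn)
        (mul_le_mul' (monomialSpan_mono y (le_max_right _ _)) le_rfl hm)⟩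
    | smul p a _ iha =>
      obtain ⟨n, hn⟩ := iha
      obtain ⟨m, hm⟩ := exists_aeval_mem_monomialSpan y p
      refine ⟨m + n, ?_⟩
      have := Submodule.mul_mem_mul hm hn
      rw [← mul_assoc] at this
      rw [Algebra.smul_def]
      exact mul_le_mul' (monomialSpan_mul_le y m n) le_rfl (hy p ▸ this)
  have hWE : (W * E).FG := (Module.Finite.iff_fg.1 inferInstance : W.FG).mul ⟨_, rfl⟩
  obtain ⟨c, hc⟩ := hWE.exists_le_of_monotone
    (F := fun n => monomialSpan k y n * E)
    (fun a b h => mul_le_mul' (monomialSpan_mono y h) le_rfl) hcov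
  -- The space `E` generates `A` as a module, and `W` acts on it with bounded degree.
  have hpow (n : ℕ) : W ^ n * E ≤ monomialSpan k y (n * c) * E := by
    induction n with
    | zero =>
      rw [pow_zero, zero_mul]
      exact mul_le_mul' (Submodule.one_le.2 (one_mem_monomialSpan y _)) le_rfl
    | succ n ih =>
      calc W ^ (n + 1) * E = W ^ n * (W * E) := by rw [pow_succ, mul_assoc]
        _ ≤ W ^ n * (monomialSpan k y c * E) := mul_le_mul' le_rfl hc
        _ = monomialSpan k y c * (W ^ n * E) := mul_left_comm _ _ _
        _ ≤ monomialSpan k y c * (monomialSpan k y (n * c) * E) := mul_le_mul' le_rfl ih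
        _ ≤ monomialSpan k y ((n + 1) * c) * E := by
          rw [← mul_assoc, add_one_mul, add_comm]
          exact mul_le_mul' (monomialSpan_mul_le y _ _) le_rfl
  refine ⟨(c + 1) ^ d * (insert 1 T : Finset A).card, fun n => ?_⟩
  have hle : W ^ n ≤ Submodule.span k (Set.range fun p : (Fin d → Fin (n * c + 1)) ×
      (insert 1 T : Finset A) => (∏ i, y i ^ (p.1 i : ℕ)) * (p.2 : A)) := by
    refine le_trans ?_ ((hpow n).trans ?_)
    · exact (mul_one (W ^ n)).ge.trans (mul_le_mul' le_rfl hE1)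
    · rw [monomialSpan, Submodule.span_mul_span, Submodule.span_le]
      rintro _ ⟨_, ⟨u, rfl⟩, e, he, rfl⟩
      exact Submodule.subset_span ⟨(u, ⟨e, he⟩), rfl⟩
  have hfd := FiniteDimensional.span_of_finite k (Set.finite_range fun p :
    (Fin d → Fin (n * c + 1)) × (insert 1 T : Finset A) => (∏ i, y i ^ (p.1 i : ℕ)) * (p.2 : A))
  refine (Submodule.finrank_mono hle).trans ((finrank_range_le_card _).trans ?_)
  rw [Fintype.card_prod, Fintype.card_fun, Fintype.card_fin, Fintype.card_fin, Fintype.card_coe,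
    mul_right_comm, ← mul_pow]
  exact Nat.mul_le_mul_right _ (Nat.pow_le_pow_left (by nlinarith) d)

end CommGrowth

/-! ### Charts from Kähler differentials -/

section Charts

open KaehlerDifferential

/-- In an affine algebra over an algebraically closed field, every element is congruent to a scalar
modulo a given maximal ideal. -/
lemma exists_sub_algebraMap_mem {k A : Type*} [Field k] [IsAlgClosed k] [CommRing A] [Algebra k A]
    [Algebra.FiniteType k A] (M : Ideal A) [M.IsMaximal] (a : A) :
    ∃ c : k, a - algebraMap k A c ∈ M := by
  let : Field (A ⧸ M) := Ideal.Quotient.field M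
  have : Algebra.FiniteType k (A ⧸ M) :=
    Algebra.FiniteType.of_surjective (Ideal.Quotient.mkₐ k M) (Ideal.Quotient.mkₐ_surjective k M)
  have : Module.Finite k (A ⧸ M) := finite_of_finite_type_of_isJacobsonRing k (A ⧸ M)
  obtain ⟨c, hc⟩ := (IsAlgClosed.algebraMap_bijective_of_isIntegral (k := k) (K := A ⧸ M)).2
    (Ideal.Quotient.mk M a)
  exact ⟨c, Ideal.Quotient.eq.1 hc.symm⟩

lemma Finset.exists_fin_range {A : Type*} [Zero A] (F : Finset A) {d : ℕ} (h : F.card ≤ d) :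
    ∃ y : Fin d → A, (F : Set A) ⊆ Set.range y ∧ ∀ i, y i = 0 ∨ y i ∈ F := by
  refine ⟨fun i => if hi : (i : ℕ) < F.card then F.equivFin.symm ⟨i, hi⟩ else 0, fun a ha => ?_,
    fun i => ?_⟩
  · refine ⟨⟨F.equivFin ⟨a, ha⟩, (F.equivFin ⟨a, ha⟩).2.trans_le h⟩, ?_⟩
    simp
  · dsimp only
    split_ifs with hi
    · exact .inr (Subtype.property _)
    · exact .inl rfl

/-- Near a maximal ideal `M`, a regular ring of dimension at most `d` has `d` functions that
generate `M`. -/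
lemma exists_generators_near {A : Type*} [CommRing A] [IsRegularRing A] {d : ℕ}
    (hd : ringKrullDim A ≤ d) (M : Ideal A) [hM : M.IsMaximal] :
    ∃ y : Fin d → A, (∀ i, y i ∈ M) ∧ ∀ a ∈ M, ∃ s ∉ M, s * a ∈ Ideal.span (Set.range y) := by
  classical
  let R := Localization.AtPrime M
  have hreg : IsRegularLocalRing R := inferInstance
  have hr : (IsLocalRing.maximalIdeal R).spanFinrank ≤ d := by
    have h1 : ((IsLocalRing.maximalIdeal R).spanFinrank : WithBot ℕ∞) ≤ d := by
      rw [hreg.spanFinrank_maximalIdeal, IsLocalization.AtPrime.ringKrullDim_eq_height M R]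
      exact (Ideal.height_le_ringKrullDim_of_ne_top hM.ne_top).trans hd
    exact_mod_cast h1
  obtain ⟨T, hT, hspan⟩ := Submodule.FG.exists_span_finset_card_eq_spanFinrank
    (IsNoetherian.noetherian (IsLocalRing.maximalIdeal R))
  choose num den hnd using fun t : R => IsLocalization.exists_mk'_eq M.primeCompl t
  obtain ⟨y, hy, hyF⟩ := (T.image num).exists_fin_range
    (Finset.card_image_le.trans (hT.trans_le hr))
  have hnum {t : R} (ht : t ∈ T) : num t ∈ M := by
    have : t ∈ IsLocalRing.maximalIdeal R := hspan ▸ Submodule.subset_span ht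
    rwa [← hnd t, IsLocalization.AtPrime.mk'_mem_maximal_iff R M] at this
  have hyM (i) : y i ∈ M := by
    rcases hyF i with h | h
    · rw [h]; exact zero_mem M
    · obtain ⟨t, ht, hti⟩ := Finset.mem_image.1 h
      exact hti ▸ hnum ht
  refine ⟨y, hyM, fun a ha => ?_⟩
  have h1 : IsLocalRing.maximalIdeal R ≤ (Ideal.span (Set.range y)).map (algebraMap A R) := by
    rw [← hspan]
    refine Submodule.span_le.2 fun t ht => ?_
    rw [← hnd t, IsLocalization.mk'_eq_mul_mk'_one]
    refine Ideal.mul_mem_right _ _ (Ideal.mem_map_of_mem _ (Ideal.subset_span (hy ?_)))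
    exact Finset.mem_coe.2 (Finset.mem_image_of_mem _ ht)
  have h2 : algebraMap A R a ∈ (Ideal.span (Set.range y)).map (algebraMap A R) :=
    h1 ((IsLocalization.AtPrime.to_map_mem_maximal_iff R M a).2 ha)
  obtain ⟨s, hs, h⟩ := (IsLocalization.algebraMap_mem_map_algebraMap_iff M.primeCompl R _ _).1 h2
  exact ⟨s, hs, h⟩

/-- Near a maximal ideal, the differentials of an affine regular algebra of dimension at most `d`
are generated by `d` exact ones. -/
lemma exists_smul_D_mem_span {k A : Type*} [Field k] [IsAlgClosed k] [CommRing A] [Algebra k A]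
    [Algebra.FiniteType k A] [IsRegularRing A] {d : ℕ} (hd : ringKrullDim A ≤ d) (M : Ideal A)
    [hM : M.IsMaximal] : ∃ f ∉ M, ∃ y : Fin d → A, ∀ a,
      f • D k A a ∈ Submodule.span A (Set.range fun i => D k A (y i)) := by
  obtain ⟨y, hyM, hy⟩ := exists_generators_near hd M
  let N : Submodule A Ω[A⁄k] := Submodule.span A (Set.range fun i => D k A (y i))
  have key : ⊤ ≤ N ⊔ M • (⊤ : Submodule A Ω[A⁄k]) := by
    refine (span_range_derivation k A).ge.trans (Submodule.span_le.2 ?_)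
    rintro _ ⟨a, rfl⟩
    obtain ⟨c, hc⟩ := exists_sub_algebraMap_mem (k := k) M a
    obtain ⟨s, hs, hsa⟩ := hy _ hc
    set a' := a - algebraMap k A c with ha'
    have hD : D k A a' = D k A a := by rw [ha', map_sub, Derivation.map_algebraMap, sub_zero]
    have hM' {r : A} (hr : r ∈ M) (x : Ω[A⁄k]) : r • x ∈ N ⊔ M • (⊤ : Submodule A Ω[A⁄k]) :=
      Submodule.mem_sup_right (Submodule.smul_mem_smul hr Submodule.mem_top)
    have hmem : ∀ x ∈ Ideal.span (Set.range y), D k A x ∈ N ⊔ M • (⊤ : Submodule A Ω[A⁄k]) := by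
      intro x hx
      obtain ⟨r, rfl⟩ := Ideal.mem_span_range_iff_exists_fun.1 hx
      rw [map_sum]
      refine Submodule.sum_mem _ fun i _ => ?_
      rw [Derivation.leibniz]
      exact add_mem (Submodule.smul_mem _ _ (Submodule.mem_sup_left
        (Submodule.subset_span ⟨i, rfl⟩))) (hM' (hyM i) _)
    have hsD : s • D k A a ∈ N ⊔ M • (⊤ : Submodule A Ω[A⁄k]) := by
      have := sub_mem (hmem _ hsa) (hM' hc (D k A s))
      rwa [Derivation.leibniz, hD, add_sub_cancel_right] at this
    obtain ⟨t, μ, hμ, ht⟩ := Ideal.IsMaximal.exists_inv hM hs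
    have := add_mem (Submodule.smul_mem _ t hsD) (hM' hμ (D k A a))
    rwa [smul_smul, ← add_smul, ht, one_smul] at this
  have hfg : (⊤ : Submodule A (Ω[A⁄k] ⧸ N)).FG := Module.Finite.fg_top
  obtain ⟨r, hr, hrN⟩ := Submodule.exists_sub_one_mem_and_smul_eq_zero_of_fg_of_le_smul M
    (⊤ : Submodule A (Ω[A⁄k] ⧸ N)) hfg (by
      have := Submodule.map_mono (f := N.mkQ) key
      rwa [Submodule.map_sup, Submodule.map_smul'', Submodule.map_top, Submodule.range_mkQ,
        Submodule.mkQ_map_self, bot_sup_eq] at this)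
  refine ⟨r, fun hrM => hM.ne_top ((Ideal.eq_top_iff_one M).2 ?_), y, fun a => ?_⟩
  · simpa using sub_mem hrM hr
  · rw [← Submodule.Quotient.mk_eq_zero, Submodule.Quotient.mk_smul]
    exact hrN _ Submodule.mem_top

end Charts

namespace PoissonAlgebra

open Enveloping

/-- A function `f` and coordinates `y` such that, where `f` is invertible, the `h_a` are
combinations of the `h_{y i}`. -/
def IsChart (k : Type*) {A : Type*} [CommRing k] [CommRing A] [Algebra k A] [PoissonAlgebra k A]
    {d : ℕ} (f : A) (y : Fin d → A) : Prop :=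
  ∀ a, ∃ b : Fin d → A, m k A f * h k A a = ∑ i, m k A (b i) * h k A (y i)

/-- The map `a ↦ h_a` is a derivation, so relations between Kähler differentials give relations in
the enveloping algebra. -/
lemma isChart_of_smul_D_mem_span {k A : Type*} [CommRing k] [CommRing A] [Algebra k A]
    [PoissonAlgebra k A] {d : ℕ} {f : A} {y : Fin d → A} (hf : ∀ a,
      f • KaehlerDifferential.D k A a ∈
        Submodule.span A (Set.range fun i => KaehlerDifferential.D k A (y i))) :
    IsChart k f y := by
  let : Module A (Enveloping k A) := Module.compHom _ (m k A).toRingHom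
  have hsmul (a : A) (u : Enveloping k A) : a • u = m k A a * u := rfl
  have : IsScalarTower k A (Enveloping k A) := ⟨fun c a u => by
    rw [hsmul, hsmul, map_smul, smul_mul_assoc]⟩
  let D : Derivation k A (Enveloping k A) := Derivation.mk' (h k A) fun a b => by
    rw [h_mul, hsmul, hsmul, add_comm]
  have hD (a : A) : D.liftKaehlerDifferential (KaehlerDifferential.D k A a) = h k A a :=
    D.liftKaehlerDifferential_comp_D a
  intro a
  obtain ⟨b, hb⟩ := (Submodule.mem_span_range_iff_exists_fun A).1 (hf a)
  refine ⟨b, ?_⟩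
  have := congrArg D.liftKaehlerDifferential hb
  simp only [map_sum, map_smul, hD, hsmul] at this
  exact this.symm

/-- Finitely many charts cover an affine regular Poisson algebra. -/
lemma exists_finset_isChart {k A : Type*} [Field k] [IsAlgClosed k] [CommRing A] [Algebra k A]
    [PoissonAlgebra k A] [Algebra.FiniteType k A] [IsRegularRing A] {d : ℕ}
    (hd : ringKrullDim A ≤ d) : ∃ T : Finset A, Ideal.span (T : Set A) = ⊤ ∧
      ∀ f ∈ T, ∃ y : Fin d → A, IsChart k f y := by
  have htop : Ideal.span {f : A | ∃ y : Fin d → A, IsChart k f y} = ⊤ := by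
    by_contra hne
    obtain ⟨M, hM, hle⟩ := Ideal.exists_le_maximal _ hne
    obtain ⟨f, hf, y, hy⟩ := exists_smul_D_mem_span (k := k) hd M
    exact hf (hle (Ideal.subset_span ⟨y, isChart_of_smul_D_mem_span hy⟩))
  obtain ⟨T, hT, hmem⟩ := Submodule.mem_span_finite_of_mem_span
    ((Ideal.eq_top_iff_one _).1 htop)
  exact ⟨T, (Ideal.eq_top_iff_one _).2 hmem, fun f hf => hT hf⟩

end PoissonAlgebra

/-! ### Ordered monomials in a chart -/

/-- A derivation that raises the degree of `W` by at most `e` does so on all powers of `W`. -/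
lemma Derivation.map_mem_pow {k A : Type*} [CommRing k] [CommRing A] [Algebra k A]
    (D : Derivation k A A) {W : Submodule k A} {e : ℕ} (h : ∀ w ∈ W, D w ∈ W ^ (1 + e)) {n : ℕ}
    {w : A} (hw : w ∈ W ^ n) : D w ∈ W ^ (n + e) := by
  induction n generalizing w with
  | zero =>
    obtain ⟨c, rfl⟩ := Submodule.mem_one.1 (pow_zero W ▸ hw)
    rw [Derivation.map_algebraMap]
    exact zero_mem _
  | succ n ih =>
    rw [pow_succ] at hw
    induction hw using Submodule.mul_induction_on' with
    | mem_mul_mem a ha b hb =>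
      rw [Derivation.leibniz, smul_eq_mul, smul_eq_mul, add_assoc]
      refine add_mem ?_ ?_
      · exact (pow_add W n _) ▸ Submodule.mul_mem_mul ha (h b hb)
      · rw [mul_comm b, add_comm 1, ← add_assoc]
        exact (pow_succ W (n + e)) ▸ Submodule.mul_mem_mul (ih ha) hb
    | add a _ b _ ha hb => rw [map_add]; exact add_mem ha hb

namespace PoissonAlgebra

open Enveloping

variable {k : Type u} {A : Type v} [Field k] [CommRing A] [Algebra k A] [PoissonAlgebra k A]
  {d : ℕ}

variable (k) in
/-- The ordered monomial in the elements `h_{y i}` with exponents given by a multiset. -/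
noncomputable def hProd (y : Fin d → A) (s : Multiset (Fin d)) : Enveloping k A :=
  ((s.sort (· ≤ ·)).map fun i => h k A (y i)).prod

lemma hProd_zero (y : Fin d → A) : hProd k y 0 = 1 := by simp [hProd]

lemma hProd_cons (y : Fin d → A) {i : Fin d} {s : Multiset (Fin d)} (hi : ∀ j ∈ s, i ≤ j) :
    hProd k y (i ::ₘ s) = h k A (y i) * hProd k y s := by
  rw [hProd, Multiset.sort_cons _ _ _ hi, List.map_cons, List.prod_cons, hProd]

/-- A finite-dimensional space `W` of functions, containing those that occur in the commutation
relations of the chart `f`, `y`, such that bracketing with a coordinate raises the degree of the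
filtration by powers of `W` by at most one. -/
structure IsAdapted (f : A) (y : Fin d → A) (W : Submodule k A) : Prop where
  one_mem : 1 ∈ W
  mem : f ∈ W
  bracket_mem (i : Fin d) : ∀ w ∈ W, bracket (k := k) (y i) w ∈ W ^ 2
  exists_h_bracket (i j : Fin d) : ∃ b : Fin d → A, (∀ l, b l ∈ W) ∧
    m k A f * h k A (bracket (k := k) (y i) (y j)) = ∑ l, m k A (b l) * h k A (y l)

/-- The span of the elements `f ^ |s| * w * h ^ s` where `h ^ s` is an ordered monomial of degree
`|s| ≤ J` and `w` has degree at most `2 * (N - |s|)` in the filtration by powers of `W`. -/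
noncomputable def pbwSpan (f : A) (y : Fin d → A) (W : Submodule k A) (J N : ℕ) :
    Submodule k (Enveloping k A) :=
  Submodule.span k {u | ∃ s : Multiset (Fin d), s.card ≤ J ∧ ∃ w ∈ W ^ (2 * (N - s.card)),
    u = m k A (f ^ s.card * w) * hProd k y s}

variable {f : A} {y : Fin d → A} {W : Submodule k A}

lemma mem_pbwSpan {J N : ℕ} {s : Multiset (Fin d)} (hs : s.card ≤ J) {w : A}
    (hw : w ∈ W ^ (2 * (N - s.card))) : m k A (f ^ s.card * w) * hProd k y s ∈ pbwSpan f y W J N :=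
  Submodule.subset_span ⟨s, hs, w, hw, rfl⟩

namespace IsAdapted

variable (hW : IsAdapted f y W)
include hW

lemma one_le : 1 ≤ W := Submodule.one_le.2 hW.one_mem

lemma pow_mono {a b : ℕ} (h : a ≤ b) : W ^ a ≤ W ^ b := pow_le_pow_right' hW.one_le h

lemma mem_pow {a b : ℕ} {w : A} (hw : w ∈ W ^ a) (h : a ≤ b) : w ∈ W ^ b := hW.pow_mono h hw

lemma bracket_mem_pow (i : Fin d) {n : ℕ} {w : A} (hw : w ∈ W ^ n) :
    bracket (k := k) (y i) w ∈ W ^ (n + 1) :=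
  Derivation.map_mem_pow (hamiltonian k (y i)) (e := 1) (hW.bracket_mem i) hw

lemma pbwSpan_mono {J J' N N' : ℕ} (hJ : J ≤ J') (hN : N ≤ N') :
    pbwSpan f y W J N ≤ pbwSpan f y W J' N' := by
  refine Submodule.span_le.2 ?_
  rintro _ ⟨s, hs, w, hw, rfl⟩
  exact mem_pbwSpan (hs.trans hJ) (hW.mem_pow hw (by omega))

omit hW in
lemma mul_mem_pbwSpan {J N c : ℕ} (hJN : J ≤ N) {a : A} (ha : a ∈ W ^ (2 * c))
    {u : Enveloping k A} (hu : u ∈ pbwSpan f y W J N) :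
    m k A a * u ∈ pbwSpan f y W J (N + c) := by
  induction hu using Submodule.span_induction with
  | mem u hu =>
    obtain ⟨s, hs, w, hw, rfl⟩ := hu
    rw [← mul_assoc, ← map_mul, mul_left_comm]
    refine mem_pbwSpan hs ?_
    rw [show 2 * (N + c - s.card) = 2 * c + 2 * (N - s.card) by omega, pow_add]
    exact Submodule.mul_mem_mul ha hw
  | zero => rw [mul_zero]; exact zero_mem _
  | add u v _ _ hu hv => rw [mul_add]; exact add_mem hu hv
  | smul c u _ hu => rw [mul_smul_comm]; exact Submodule.smul_mem _ c hu

omit hW in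
/-- Multiplication by an element of degree at most two raises the level by one. -/
lemma mul_mem_pbwSpan_succ {J N : ℕ} (hJN : J ≤ N) {a : A} (ha : a ∈ W ^ 2)
    {u : Enveloping k A} (hu : u ∈ pbwSpan f y W J N) :
    m k A a * u ∈ pbwSpan f y W J (N + 1) :=
  mul_mem_pbwSpan hJN (c := 1) ha hu

/-- The factor `f` makes room for the bracket of `y i` with the power of `f` in an element of
`pbwSpan`. -/
lemma h_mul_mem_pbwSpan_aux {J N : ℕ} (hJN : J ≤ N)
    (hR : ∀ s : Multiset (Fin d), s.card ≤ J → ∀ i,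
      m k A (f ^ (s.card + 1)) * (h k A (y i) * hProd k y s) ∈
        pbwSpan f y W (s.card + 1) (s.card + 1))
    {u : Enveloping k A} (hu : u ∈ pbwSpan f y W J N) (i : Fin d) :
    h k A (y i) * (m k A f * u) ∈ pbwSpan f y W (J + 1) (N + 1) := by
  induction hu using Submodule.span_induction with
  | mem u hu =>
    obtain ⟨s, hs, w, hw, rfl⟩ := hu
    have hbr : bracket (k := k) (y i) (f * (f ^ s.card * w)) = f ^ s.card *
        (f * bracket (k := k) (y i) w + (s.card + 1) • (w * bracket (k := k) (y i) f)) := by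
      rw [← mul_assoc, ← pow_succ', ← hamiltonian_apply, Derivation.leibniz,
        Derivation.leibniz_pow, hamiltonian_apply, hamiltonian_apply]
      simp only [smul_eq_mul, Nat.add_sub_cancel, nsmul_eq_mul]
      ring
    rw [← mul_assoc (m k A f), ← map_mul, ← mul_assoc, h_mul_m, add_mul, hbr]
    refine add_mem ?_ (mem_pbwSpan (hs.trans (Nat.le_succ J)) (add_mem ?_ (nsmul_mem ?_ _)))
    · have h1 := mul_mem_pbwSpan le_rfl hw (hR s hs i)
      rw [← mul_assoc, ← map_mul, ← mul_assoc] at h1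
      rw [← mul_assoc f, ← pow_succ', mul_comm _ w]
      exact hW.pbwSpan_mono (by omega) (by omega) h1
    · have := Submodule.mul_mem_mul hW.mem (hW.bracket_mem_pow i hw)
      rw [← pow_succ'] at this
      exact hW.mem_pow this (by omega)
    · have := Submodule.mul_mem_mul hw (hW.bracket_mem i f hW.mem)
      rw [← pow_add] at this
      exact hW.mem_pow this (by omega)
  | zero => rw [mul_zero, mul_zero]; exact zero_mem _
  | add u v _ _ hu hv => rw [mul_add, mul_add]; exact add_mem hu hv
  | smul c u _ hu => rw [mul_smul_comm, mul_smul_comm]; exact Submodule.smul_mem _ c hu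

/-- Since `f ^ (N + 1) * h_i = h_i * f ^ (N + 1) - (N + 1) * f ^ N * {y i, f}`, left multiplication
by `h_i` raises the level by one, as soon as it does so on the ordered monomials. -/
lemma h_mul_mem_pbwSpan_of {J N : ℕ} (hJN : J ≤ N)
    (hR : ∀ s : Multiset (Fin d), s.card ≤ J → ∀ i,
      m k A (f ^ (s.card + 1)) * (h k A (y i) * hProd k y s) ∈
        pbwSpan f y W (s.card + 1) (s.card + 1))
    {u : Enveloping k A} (hu : m k A (f ^ N) * u ∈ pbwSpan f y W J N) (i : Fin d) :
    m k A (f ^ (N + 1)) * (h k A (y i) * u) ∈ pbwSpan f y W (J + 1) (N + 1) := by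
  have hbr : bracket (k := k) (y i) (f ^ (N + 1)) =
      ((N + 1) • bracket (k := k) (y i) f) * f ^ N := by
    rw [← hamiltonian_apply, Derivation.leibniz_pow, hamiltonian_apply]
    simp only [smul_eq_mul, Nat.add_sub_cancel, nsmul_eq_mul]
    ring
  have heq : m k A (f ^ (N + 1)) * (h k A (y i) * u) =
      h k A (y i) * (m k A f * (m k A (f ^ N) * u)) -
        m k A ((N + 1) • bracket (k := k) (y i) f) * (m k A (f ^ N) * u) := by
    rw [← mul_assoc (m k A f), ← map_mul, ← pow_succ', ← mul_assoc (h k A (y i)), h_mul_m, hbr,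
      add_mul, map_mul (m k A) _ (f ^ N), mul_assoc, mul_assoc, add_sub_cancel_right]
  rw [heq]
  refine sub_mem (hW.h_mul_mem_pbwSpan_aux hJN hR hu i) ?_
  exact hW.pbwSpan_mono (Nat.le_succ J) le_rfl
    (mul_mem_pbwSpan_succ hJN (nsmul_mem (hW.bracket_mem i f hW.mem) _) hu)

lemma pow_mul_hProd_mem (s : Multiset (Fin d)) :
    m k A (f ^ s.card) * hProd k y s ∈ pbwSpan f y W s.card s.card := by
  have := mem_pbwSpan (k := k) (f := f) (y := y) (W := W) (N := s.card) le_rfl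
    (Submodule.one_le.1 (one_le_pow_of_one_le' hW.one_le (2 * (s.card - s.card))))
  rwa [mul_one] at this

/-- Reordering: modulo terms of lower order, `h_i` times an ordered monomial is an ordered
monomial. -/
lemma h_mul_hProd_sub_mem (n : ℕ) : ∀ s : Multiset (Fin d), s.card = n → ∀ i,
    m k A (f ^ (n + 1)) * (h k A (y i) * hProd k y s - hProd k y (i ::ₘ s)) ∈
      pbwSpan f y W n (n + 1) := by
  induction n using Nat.strong_induction_on with
  | _ n ih =>
  have hR : ∀ s : Multiset (Fin d), s.card < n → ∀ i,
      m k A (f ^ (s.card + 1)) * (h k A (y i) * hProd k y s) ∈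
        pbwSpan f y W (s.card + 1) (s.card + 1) := by
    intro s hs i
    have h1 := ih _ hs s rfl i
    have h2 := hW.pow_mul_hProd_mem (i ::ₘ s)
    rw [Multiset.card_cons] at h2
    have := add_mem (hW.pbwSpan_mono (Nat.le_succ _) le_rfl h1) h2
    rwa [mul_sub, sub_add_cancel] at this
  intro s hs i
  rcases Multiset.forall_le_or_exists_cons i s with h | ⟨l, s', rfl, hl, hli⟩
  · rw [hProd_cons y h, sub_self, mul_zero]
    exact zero_mem _
  · obtain ⟨n, rfl⟩ : ∃ n', n = n' + 1 := ⟨s'.card, by rw [← hs, Multiset.card_cons]⟩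
    rw [Multiset.card_cons, Nat.succ_inj] at hs
    obtain ⟨b, hb, hfb⟩ := hW.exists_h_bracket i l
    -- Move `h_i` past the smallest index `l`; one factor `f` expands `h` of the bracket.
    have heq : m k A (f ^ (n + 1 + 1)) * (h k A (y i) * hProd k y (l ::ₘ s') -
          hProd k y (i ::ₘ l ::ₘ s')) =
        m k A (f ^ (n + 1 + 1)) * (h k A (y l) * (h k A (y i) * hProd k y s' -
          hProd k y (i ::ₘ s'))) +
        ∑ r, m k A (b r) * (m k A (f ^ (n + 1)) * (h k A (y r) * hProd k y s')) := by
      have hsum : ∑ r, m k A (b r) * (m k A (f ^ (n + 1)) * (h k A (y r) * hProd k y s')) =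
          m k A (f ^ (n + 1)) * (∑ r, m k A (b r) * h k A (y r)) * hProd k y s' := by
        rw [Finset.mul_sum, Finset.sum_mul]
        refine Finset.sum_congr rfl fun r _ => ?_
        rw [← mul_assoc, ← map_mul, mul_comm (b r), map_mul]
        simp only [mul_assoc]
      have hle : ∀ j ∈ i ::ₘ s', l ≤ j := by
        intro j hj
        rcases Multiset.mem_cons.1 hj with rfl | hj
        exacts [hl.le, hli j hj]
      rw [hsum, ← hfb, Multiset.cons_swap, hProd_cons y hle, hProd_cons y hli, h_bracket,
        pow_succ _ (n + 1), map_mul]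
      noncomm_ring
    rw [heq]
    refine add_mem ?_ (Submodule.sum_mem _ fun r _ => ?_)
    · refine hW.h_mul_mem_pbwSpan_of (Nat.le_succ n) (fun s'' hs'' => hR s'' (by omega))
        (ih n (by omega) s' hs i) l
    · subst hs
      exact mul_mem_pbwSpan_succ le_rfl (hW.mem_pow (a := 1) (by simpa using hb r) (by omega))
        (hR s' (by omega) r)

/-- Left multiplication by `h_i` raises the level by one. -/
lemma h_mul_mem_pbwSpan {N : ℕ} {u : Enveloping k A}
    (hu : m k A (f ^ N) * u ∈ pbwSpan f y W N N) (i : Fin d) :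
    m k A (f ^ (N + 1)) * (h k A (y i) * u) ∈ pbwSpan f y W (N + 1) (N + 1) := by
  refine hW.h_mul_mem_pbwSpan_of le_rfl (fun s _ i => ?_) hu i
  have h2 := hW.pow_mul_hProd_mem (i ::ₘ s)
  rw [Multiset.card_cons] at h2
  have := add_mem (hW.pbwSpan_mono (Nat.le_succ _) le_rfl (hW.h_mul_hProd_sub_mem _ s rfl i)) h2
  rwa [mul_sub, sub_add_cancel] at this

end IsAdapted

end PoissonAlgebra

/-! ### The upper bound -/

lemma exists_mem_pow_of_adjoin_eq_top {k R : Type*} [CommRing k] [Ring R] [Algebra k R]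
    {V : Submodule k R} (h1 : 1 ≤ V) (hV : Algebra.adjoin k (V : Set R) = ⊤) (x : R) :
    ∃ n, x ∈ V ^ n := by
  have hx : x ∈ Algebra.adjoin k (V : Set R) := hV ▸ Algebra.mem_top
  induction hx using Algebra.adjoin_induction with
  | mem x hx => exact ⟨1, by simpa using hx⟩
  | algebraMap r => exact ⟨0, by rw [pow_zero]; exact Submodule.algebraMap_mem r⟩
  | add x y _ _ hx hy =>
    obtain ⟨n, hn⟩ := hx
    obtain ⟨m, hm⟩ := hy
    exact ⟨max n m, add_mem (pow_le_pow_right' h1 (le_max_left n m) hn)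
      (pow_le_pow_right' h1 (le_max_right n m) hm)⟩
  | mul x y _ _ hx hy =>
    obtain ⟨n, hn⟩ := hx
    obtain ⟨m, hm⟩ := hy
    exact ⟨n + m, pow_add V n m ▸ Submodule.mul_mem_mul hn hm⟩

namespace PoissonAlgebra

open Enveloping

variable {k : Type u} {A : Type v} [Field k] [CommRing A] [Algebra k A] [PoissonAlgebra k A]
  {d : ℕ}

/-- The space spanned by the generators `m_a` and `h_a` of the enveloping algebra, for `a` in a
finite set, together with `1`. -/
noncomputable def generatorSpan (k : Type u) {A : Type v} [Field k] [CommRing A] [Algebra k A]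
    [PoissonAlgebra k A] (S : Finset A) : Submodule k (Enveloping k A) :=
  Submodule.span k (insert 1 (m k A '' S ∪ h k A '' S))

lemma m_mem_generatorSpan {S : Finset A} {a : A} (ha : a ∈ S) : m k A a ∈ generatorSpan k S :=
  Submodule.subset_span (.inr (.inl ⟨a, ha, rfl⟩))

lemma h_mem_generatorSpan {S : Finset A} {a : A} (ha : a ∈ S) : h k A a ∈ generatorSpan k S :=
  Submodule.subset_span (.inr (.inr ⟨a, ha, rfl⟩))

lemma one_le_generatorSpan (S : Finset A) : 1 ≤ generatorSpan k S :=
  Submodule.one_le.2 (Submodule.subset_span (.inl rfl))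

instance (S : Finset A) : FiniteDimensional k (generatorSpan k S) :=
  FiniteDimensional.span_of_finite k
    (((S.finite_toSet.image _).union (S.finite_toSet.image _)).insert 1)

lemma adjoin_generatorSpan {S : Finset A} (hS : Algebra.adjoin k (S : Set A) = ⊤) :
    Algebra.adjoin k (generatorSpan k S : Set (Enveloping k A)) = ⊤ := by
  set B := Algebra.adjoin k (generatorSpan k S : Set (Enveloping k A))
  have key (a : A) : m k A a ∈ B ∧ h k A a ∈ B := by
    have ha : a ∈ Algebra.adjoin k (S : Set A) := hS ▸ Algebra.mem_top
    have hh1 : h k A 1 = 0 := by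
      have := h_mul (k := k) (1 : A) 1
      rwa [mul_one, map_one (m k A), one_mul, left_eq_add] at this
    induction ha using Algebra.adjoin_induction with
    | mem a ha => exact ⟨Algebra.subset_adjoin (m_mem_generatorSpan ha),
        Algebra.subset_adjoin (h_mem_generatorSpan ha)⟩
    | algebraMap r =>
      rw [AlgHom.commutes, Algebra.algebraMap_eq_smul_one (A := A), map_smul, hh1, smul_zero]
      exact ⟨B.algebraMap_mem r, B.zero_mem⟩
    | add a b _ _ ha hb =>
      rw [map_add, map_add]
      exact ⟨add_mem ha.1 hb.1, add_mem ha.2 hb.2⟩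
    | mul a b _ _ ha hb =>
      rw [map_mul, h_mul]
      exact ⟨mul_mem ha.1 hb.1, add_mem (mul_mem hb.1 ha.2) (mul_mem ha.1 hb.2)⟩
  rw [eq_top_iff, ← adjoin_eq_top, Algebra.adjoin_le_iff]
  rintro _ (⟨a, rfl⟩ | ⟨a, rfl⟩)
  exacts [(key a).1, (key a).2]

/-- A space adapted to a chart can be chosen to contain the coefficients of the differentials of any
given generators. -/
lemma IsChart.exists_isAdapted {f : A} {y : Fin d → A} (hf : IsChart k f y) {S : Finset A}
    (hS : Algebra.adjoin k (S : Set A) = ⊤) :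
    ∃ W : Submodule k A, FiniteDimensional k W ∧ IsAdapted f y W ∧ (∀ a ∈ S, a ∈ W) ∧
      ∀ a ∈ S, ∃ b : Fin d → A, (∀ l, b l ∈ W) ∧
        m k A f * h k A a = ∑ l, m k A (b l) * h k A (y l) := by
  classical
  choose b hb using hf
  let T : Set A := insert 1 (insert f (S ∪
    ((⋃ a ∈ S, Set.range (b a)) ∪
      ⋃ (i : Fin d) (j : Fin d), Set.range (b (bracket (k := k) (y i) (y j))))))
  have hT : T.Finite := by
    refine Set.Finite.insert _ (Set.Finite.insert _ (S.finite_toSet.union (Set.Finite.union ?_ ?_)))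
    · exact S.finite_toSet.biUnion fun a _ => Set.finite_range _
    · exact Set.finite_iUnion fun i => Set.finite_iUnion fun j => Set.finite_range _
  let W₀ : Submodule k A := Submodule.span k T
  have hfd : FiniteDimensional k W₀ := FiniteDimensional.span_of_finite k hT
  have hsub {a : A} (ha : a ∈ T) : a ∈ W₀ := Submodule.subset_span ha
  have h1 : 1 ≤ W₀ := Submodule.one_le.2 (hsub (by simp [T]))
  have hSW {a : A} (ha : a ∈ S) : a ∈ W₀ := hsub (by simp [T, ha])
  have hadj : Algebra.adjoin k (W₀ : Set A) = ⊤ := by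
    rw [eq_top_iff, ← hS]
    exact Algebra.adjoin_mono fun a ha => hSW ha
  have hfg : (⨆ i, W₀.map (bracket (k := k) (y i))).FG :=
    Submodule.fg_iSup _ fun i => (Module.Finite.iff_fg.1 hfd).map _
  obtain ⟨e, he⟩ := hfg.exists_le_of_monotone (F := fun n => W₀ ^ n)
    (fun a b h => pow_le_pow_right' h1 h) (exists_mem_pow_of_adjoin_eq_top h1 hadj)
  -- Bracketing with a coordinate raises degrees for `W₀` by at most `e + 1`, so it maps the
  -- `(e + 1)`-st power of `W₀` to the square of that power.
  have hW₀ : W₀ ≤ W₀ ^ (e + 1) := (pow_one W₀).ge.trans (pow_le_pow_right' h1 (by omega))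
  refine ⟨W₀ ^ (e + 1), Module.Finite.iff_fg.2 ((Module.Finite.iff_fg.1 hfd).pow _),
    ⟨hW₀ (Submodule.one_le.1 h1), hW₀ (hsub (by simp [T])), fun i w hw => ?_, fun i j => ?_⟩,
    fun a ha => hW₀ (hSW ha), fun a ha => ⟨b a, fun l => hW₀ (hsub ?_), hb a⟩⟩
  · rw [← pow_mul, mul_two]
    refine Derivation.map_mem_pow (hamiltonian k (y i)) (fun x hx => ?_) hw
    exact pow_le_pow_right' h1 (by omega)
      (he (le_iSup (fun i => W₀.map (bracket (k := k) (y i))) i ⟨x, hx, rfl⟩))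
  · refine ⟨_, fun l => hW₀ (hsub ?_), hb _⟩
    refine .inr (.inr (.inr (.inr ?_)))
    simp only [Set.mem_iUnion]
    exact ⟨i, j, l, rfl⟩
  · refine .inr (.inr (.inr (.inl ?_)))
    simp only [Set.mem_iUnion]
    exact ⟨a, ha, l, rfl⟩

variable {f : A} {y : Fin d → A} {W : Submodule k A}

/-- Multiplied by `f ^ (2 * n)`, the `n`-th power of the generators lies in the span of ordered
monomials of level `2 * n`. -/
lemma IsAdapted.mul_mem_of_mem_pow (hW : IsAdapted f y W) {S : Finset A} (hS : ∀ a ∈ S, a ∈ W)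
    (hSh : ∀ a ∈ S, ∃ b : Fin d → A, (∀ l, b l ∈ W) ∧
        m k A f * h k A a = ∑ l, m k A (b l) * h k A (y l)) {n : ℕ} {u : Enveloping k A}
    (hu : u ∈ generatorSpan k S ^ n) :
    m k A (f ^ (2 * n)) * u ∈ pbwSpan f y W (2 * n) (2 * n) := by
  have hm {N : ℕ} {a : A} (ha : a ∈ W) {u : Enveloping k A}
      (hu : m k A (f ^ N) * u ∈ pbwSpan f y W N N) :
      m k A (f ^ (N + 1)) * (m k A a * u) ∈ pbwSpan f y W (N + 1) (N + 1) := by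
    rw [← mul_assoc, ← map_mul, show f ^ (N + 1) * a = f * a * f ^ N by ring, map_mul, mul_assoc]
    refine hW.pbwSpan_mono (Nat.le_succ N) le_rfl (mul_mem_pbwSpan_succ le_rfl ?_ hu)
    exact pow_two W ▸ Submodule.mul_mem_mul hW.mem ha
  induction n generalizing u with
  | zero =>
    obtain ⟨c, rfl⟩ := Submodule.mem_one.1 (pow_zero (generatorSpan k S) ▸ hu)
    have := Submodule.smul_mem _ c (hW.pow_mul_hProd_mem 0)
    rwa [Multiset.card_zero, hProd_zero, mul_one, pow_zero, map_one,
      ← Algebra.algebraMap_eq_smul_one, ← one_mul (algebraMap k _ c), ← map_one (m k A),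
      ← pow_zero f] at this
  | succ n ih =>
    rw [pow_succ'] at hu
    induction hu using Submodule.mul_induction_on' with
    | mem_mul_mem a ha b hb =>
      have hb' := ih hb
      change m k A (f ^ (2 * n + 2)) * _ ∈ pbwSpan f y W (2 * n + 2) (2 * n + 2)
      clear hb
      induction ha using Submodule.span_induction with
      | mem a ha =>
        rcases ha with rfl | ⟨a, ha, rfl⟩ | ⟨a, ha, rfl⟩
        · have := hm hW.one_mem (hm hW.one_mem hb')
          rwa [map_one, one_mul] at this
        · have := hm hW.one_mem (hm (hS a ha) hb')
          rwa [map_one, one_mul] at this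
        · obtain ⟨c, hc, hca⟩ := hSh a ha
          have heq : m k A (f ^ (2 * n + 2)) * (h k A a * b) =
              ∑ l, m k A (c l) * (m k A (f ^ (2 * n + 1)) * (h k A (y l) * b)) := by
            have : m k A (f ^ (2 * n + 2)) * (h k A a * b) =
                m k A (f ^ (2 * n + 1)) * (m k A f * h k A a) * b := by
              rw [pow_succ, map_mul]
              simp only [mul_assoc]
            rw [this, hca, Finset.mul_sum, Finset.sum_mul]
            refine Finset.sum_congr rfl fun l _ => ?_
            rw [← mul_assoc (m k A (c l)), ← map_mul, mul_comm (c l), map_mul]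
            simp only [mul_assoc]
          rw [heq]
          refine Submodule.sum_mem _ fun l _ => ?_
          exact hW.pbwSpan_mono (Nat.le_succ _) le_rfl (mul_mem_pbwSpan_succ le_rfl
            (hW.mem_pow (a := 1) (by simpa using hc l) (by omega)) (hW.h_mul_mem_pbwSpan hb' l))
      | zero => rw [zero_mul, mul_zero]; exact zero_mem _
      | add x z _ _ hx hz => rw [add_mul, mul_add]; exact add_mem hx hz
      | smul c x _ hx => rw [smul_mul_assoc, mul_smul_comm]; exact Submodule.smul_mem _ c hx
    | add a _ b _ ha hb => rw [mul_add (m k A _)]; exact add_mem ha hb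

lemma pbwSpan_le_iSup (hW : IsAdapted f y W) (N : ℕ) : pbwSpan f y W N N ≤
    ⨆ t : Fin d → Fin (N + 1), (W ^ (2 * N)).map
      (LinearMap.mulRight k (hProd k y (Finsupp.toMultiset (Finsupp.equivFunOnFinite.symm
        fun i => (t i : ℕ)))) ∘ₗ (m k A).toLinearMap ∘ₗ
          LinearMap.mulLeft k (f ^ (∑ i, (t i : ℕ)))) := by
  refine Submodule.span_le.2 ?_
  rintro _ ⟨s, hs, w, hw, rfl⟩
  let t : Fin d → Fin (N + 1) := fun i =>
    ⟨s.count i, Nat.lt_succ_of_le ((Multiset.count_le_card i s).trans hs)⟩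
  have ht : Finsupp.toMultiset (Finsupp.equivFunOnFinite.symm fun i => (t i : ℕ)) = s := by
    ext i
    rw [Finsupp.count_toMultiset]
    rfl
  have hcard : ∑ i, (t i : ℕ) = s.card := by
    exact Multiset.sum_count_eq_card fun _ _ => Finset.mem_univ _
  refine Submodule.mem_iSup_of_mem t ⟨w, hW.mem_pow hw (by omega), ?_⟩
  simp [ht, hcard]

/-- The ordered monomials of level `N` span a space of dimension at most `(N + 1) ^ d` times that
of the coefficients. -/
lemma finrank_pbwSpan_le [FiniteDimensional k W] (hW : IsAdapted f y W) (N : ℕ) :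
    FiniteDimensional k (pbwSpan f y W N N) ∧ Module.finrank k (pbwSpan f y W N N) ≤
      (N + 1) ^ d * Module.finrank k ↥(W ^ (2 * N)) := by
  have : FiniteDimensional k ↥(W ^ (2 * N)) :=
    Module.Finite.iff_fg.2 (Submodule.FG.pow (Module.Finite.iff_fg.1 inferInstance) _)
  have hle := pbwSpan_le_iSup hW N
  refine ⟨Submodule.finiteDimensional_of_le hle, (Submodule.finrank_mono hle).trans ?_⟩
  refine (Submodule.finrank_iSup_le_of_fintype _ fun t => Submodule.finrank_map_le _ _).trans ?_
  rw [Fintype.card_fun, Fintype.card_fin, Fintype.card_fin]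

/-- The growth of the enveloping algebra is bounded chart by chart: if the `f` generate the unit
ideal, then so do their powers, so an element is determined by its products with these powers. -/
theorem gelfandKirillovDim_enveloping_le [IsAlgClosed k] [Algebra.FiniteType k A] [IsRegularRing A]
    {g : MvPolynomial (Fin d) k →ₐ[k] A} (hg : g.Finite) (hd : ringKrullDim A ≤ d) :
    gelfandKirillovDim k (Enveloping k A) ≤ ((2 * d : ℕ) : EReal) := by
  obtain ⟨T, hT, hchart⟩ := exists_finset_isChart (k := k) hd
  obtain ⟨S, hS⟩ := (‹Algebra.FiniteType k A›).out
  choose! y hy using hchart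
  have hex (f : T) := (hy f f.2).exists_isAdapted hS
  choose W hWfd hW hSW hSh using hex
  have hgrow (f : T) := exists_finrank_pow_le hg (W f)
  choose C hC using hgrow
  have key (n : ℕ) : Module.finrank k ↥(generatorSpan k S ^ n) ≤
      ∑ f : T, (2 * n + 1) ^ d * (C f * (4 * n + 1) ^ d) := by
    have hfd (f : T) := (finrank_pbwSpan_le (hW f) (2 * n)).1
    let φ : ↥(generatorSpan k S ^ n) →ₗ[k] ∀ f : T, pbwSpan f.1 (y f) (W f) (2 * n) (2 * n) :=
      LinearMap.pi fun f => LinearMap.codRestrict _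
        (LinearMap.mulLeft k (m k A (f.1 ^ (2 * n))) ∘ₗ Submodule.subtype _) fun u =>
          (hW f).mul_mem_of_mem_pow (hSW f) (hSh f) u.2
    have hφ : Function.Injective φ := by
      rw [← LinearMap.ker_eq_bot, LinearMap.ker_eq_bot']
      intro u hu
      have hu' (f : A) (hf : f ∈ T) : m k A (f ^ (2 * n)) * (u : Enveloping k A) = 0 :=
        congrArg Subtype.val (congrFun hu ⟨f, hf⟩)
      have hspan := Ideal.span_pow_eq_top (T : Set A) hT (2 * n)
      have hall : ∀ a ∈ Ideal.span ((fun x => x ^ (2 * n)) '' (T : Set A)),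
          m k A a * (u : Enveloping k A) = 0 := by
        intro a ha
        induction ha using Submodule.span_induction with
        | mem a ha =>
          obtain ⟨f, hf, rfl⟩ := ha
          exact hu' f hf
        | zero => rw [map_zero, zero_mul]
        | add a b _ _ ha hb => rw [map_add, add_mul, ha, hb, add_zero]
        | smul c a _ ha => rw [smul_eq_mul, map_mul, mul_assoc, ha, mul_zero]
      have := hall 1 (hspan ▸ Submodule.mem_top)
      rw [map_one, one_mul] at this
      exact Subtype.ext this
    refine (LinearMap.finrank_le_finrank_of_injective hφ).trans ?_
    rw [Module.finrank_pi_fintype]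
    refine Finset.sum_le_sum fun f _ => (finrank_pbwSpan_le (hW f) (2 * n)).2.trans ?_
    refine Nat.mul_le_mul_left _ ((hC f _).trans (le_of_eq ?_))
    rw [show 2 * (2 * n) = 4 * n by ring]
  refine gelfandKirillovDim_le_of_le_pow fun V hV => ?_
  obtain ⟨q, hq⟩ := (Module.Finite.iff_fg.1 hV).exists_le_of_monotone
    (F := fun n => generatorSpan k S ^ n)
    (fun a b h => pow_le_pow_right' (one_le_generatorSpan S) h)
    (exists_mem_pow_of_adjoin_eq_top (one_le_generatorSpan S) (adjoin_generatorSpan hS))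
  refine ⟨(∑ f, C f) * (4 * q + 1) ^ (2 * d), fun n hn => ?_⟩
  have hle : (⨆ i ∈ Finset.range (n + 1), V ^ i) ≤ generatorSpan k S ^ (q * n) := by
    refine iSup₂_le fun i hi => (pow_le_pow_left' hq i).trans ?_
    rw [← pow_mul]
    exact pow_le_pow_right' (one_le_generatorSpan S)
      (Nat.mul_le_mul_left q (Nat.le_of_lt_succ (Finset.mem_range.1 hi)))
  have hfd : FiniteDimensional k ↥(generatorSpan k S ^ (q * n)) :=
    Module.Finite.iff_fg.2 (Submodule.FG.pow (Module.Finite.iff_fg.1 inferInstance) _)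
  refine (Submodule.finrank_mono hle).trans ((key _).trans ?_)
  rw [Finset.sum_mul, Finset.sum_mul]
  refine Finset.sum_le_sum fun f _ => ?_
  have h1 : 2 * (q * n) + 1 ≤ (4 * q + 1) * n := by nlinarith
  have h2 : 4 * (q * n) + 1 ≤ (4 * q + 1) * n := by nlinarith
  calc (2 * (q * n) + 1) ^ d * (C f * (4 * (q * n) + 1) ^ d)
      ≤ ((4 * q + 1) * n) ^ d * (C f * ((4 * q + 1) * n) ^ d) := by gcongr
    _ = C f * (4 * q + 1) ^ (2 * d) * n ^ (2 * d) := by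
      rw [two_mul d, mul_pow, pow_add, pow_add]
      ring

end PoissonAlgebra

/-- If an affine Poisson algebra `A` over an algebraically closed field of characteristic zero is
regular of global dimension `t`, then its Poisson enveloping algebra has
Gelfand-Kirillov dimension `2t`. -/
theorem proposition2p1 (k : Type u) (A : Type v) [Field k] [IsAlgClosed k] [CharZero k]
    [CommRing A] [Algebra k A] [PoissonAlgebra k A]
    (hfin : Algebra.FiniteType k A) (hreg : IsRegularRing A)
    (t : ℕ) (ht : globalDim A = t) :
    gelfandKirillovDim k (PoissonAlgebra.Enveloping k A) = ((2 * t : ℕ) : EReal) := by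
  -- Over the zero ring the supremum defining `globalDim` is `⊥`, not a natural number.
  have hA : Nontrivial A := by
    by_contra hA
    rw [not_nontrivial_iff_subsingleton] at hA
    have hbot : globalDim A = ⊥ := iSup_eq_bot.2 fun M => by
      have : Subsingleton M := Module.subsingleton A M
      exact (CategoryTheory.projectiveDimension_eq_bot_iff _).2
        (ModuleCat.isZero_of_subsingleton M)
    rw [hbot] at ht
    exact absurd ht.symm (WithBot.coe_ne_bot (a := (t : ℕ∞)))
  obtain ⟨d, g, hg, hgf, hd⟩ := exists_finite_inj_algHom_ringKrullDim_eq k A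
  obtain rfl : d = t := by
    have := (globalDim_eq_ringKrullDim hd).symm.trans ht
    exact_mod_cast this
  obtain ⟨K, _, _, _, _, C, -, hC⟩ :=
    PoissonAlgebra.exists_coordinates hg hgf.to_isIntegral
  exact le_antisymm (PoissonAlgebra.gelfandKirillovDim_enveloping_le hgf hd.le)
    (C.le_gelfandKirillovDim hC)
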